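/- **Setting.** Fix $\rho>1$. Let $\mathcal W_\rho$ be the Banach space of loops $h=\sum_{k\in\mathbb Z}h_k\lambda^k$ on $\mathbb S^1$ with $\|h\|_\rho=\sum_k|h_k|\rho^{|k|}<\infty$, and let $\mathcal W^{\ge0}_{\mathbb R,\rho}$ be the real subspace of those $h$ with $h_k\in\mathbb R$ for all $k$ and $h_k=0$ for $k<0$. Write $h^*(\lambda)=\overline{h(1/\overline\lambda)}$. Let $\varphi\in(0,\frac\pi2)$ and $$p_1=e^{i\varphi},\quad p_2=-e^{-i\varphi},\quad p_3=-e^{i\varphi},\quad p_4=e^{-i\varphi},\qquad \Sigma=\mathbb{CP}^1\setminus\{p_1,\dots,p_4\}.$$ For a parameter vector $\mathbf x=(\tilde a,\tilde b,\tilde c,r,\theta)\in(\mathcal W^{\ge0}_{\mathbb R,\rho})^3\times\mathbb R^2$ put $$a=\tfrac12(\lambda^{-1}-\lambda)+\tilde a,\qquad b=-\tfrac12\sin(\varphi)(\lambda^{-1}+\lambda)+\tilde b,\qquad c=-\tfrac12\cos(\varphi)(\lambda^{-1}+\lambda)+\tilde c,$$ $$A_1=\begin{pmatrix}ia&b+ic\\b-ic&-ia\end{pmatrix},\quad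 A_2=\begin{pmatrix}-ia&-b+ic\\-b-ic&ia\end{pmatrix},\quad A_3=\begin{pmatrix}ia&-b-ic\\-b+ic&-ia\end{pmatrix},\quad A_4=\begin{pmatrix}-ia&b-ic\\b+ic&ia\end{pmatrix},$$ and for $t\in\mathbb R$ let $$\eta^{\mathbf x}_{t,\varphi}=r\,t\sum_{k=1}^4A_k(\lambda)\frac{dz}{z-p_k}.$$ The central value is $\underline{\mathbf x}=(0,0,0,1,\frac\pi2)$. For $\lambda\in\mathbb S^1$ let $\Phi$ solve $d\Phi=\Phi\,\eta^{\mathbf x}_{t,\varphi}$, $\Phi(0)=\mathrm{Id}$, along the straight segments from $0$ to $1$ and from $0$ to $i$; let $\mathcal P=\Phi(1)$, $\mathcal Q=\Phi(i)$ and $$\mathfrak p=\mathcal P_{11}\mathcal P_{21}-\mathcal P_{12}\mathcal P_{22},\qquad \mathfrak q=i(\mathcal Q_{11}\mathcal Q_{21}+\mathcal Q_{12}\mathcal Q_{22}).$$ For fixed $\mathbf x$ and $\lambda$, and a function $f$ of $t$, let $\widehat f(t)=(f(t)-f(0))/t$ for $t\ne0$ and $\widehat f(0)=f'(0)$. Put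 $$\mathcal F=\widehat{\mathfrak p}-\widehat{\mathfrak p}^{\,*},\quad \mathcal G=\widehat{\mathfrak q}-\widehat{\mathfrak q}^{\,*},\quad \mathcal K=\det(rA_1),\quad \mathcal H_1=\widehat{\mathfrak p}|_{\lambda=e^{i\theta}},\quad \mathcal H_2=\widehat{\mathfrak q}|_{\lambda=e^{i\theta}}.$$ The pair $(t,\mathbf x)$ *solves the monodromy problem* if $\mathcal F=\mathcal G=0$ and $\mathcal K=-1$ on $\mathbb S^1$, $\theta\in(0,\pi)$, and $\mathcal H_1=\mathcal H_2=0$. **Proposition.** For every $\varphi\in(0,\frac\pi2)$ there are $\varepsilon>0$, a neighbourhood $U$ of $\underline{\mathbf x}$ in $(\mathcal W^{\ge0}_{\mathbb R,\rho})^3\times\mathbb R^2$ and a family $\mathbf x(t)\in U$, real analytic in $t\in(-\varepsilon,\varepsilon)$, with $\mathbf x(0)=\underline{\mathbf x}$, such that for every $t\in(-\varepsilon,\varepsilon)$ the pair $(t,\mathbf x(t))$ solves the monodromy problem, and $\mathbf x(t)$ is the only $\mathbf y\in U$ for which $(t,\mathbf y)$ solves it. The potentials $\eta_t=\eta^{\mathbf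 x(t)}_{t,\varphi}$ are symmetric: $$\delta^*\eta_t=D^{-1}\eta_tD,\qquad \tau^*\eta_t=C^{-1}\eta_tC,\qquad \sigma^*\overline{\eta_t(\cdot,\overline\lambda)}=\eta_t(\cdot,\lambda),$$ where $\delta(z)=-z$, $\tau(z)=1/z$, $\sigma(z)=\overline z$, $D=\begin{pmatrix}i&0\\0&-i\end{pmatrix}$, $C=\begin{pmatrix}0&i\\i&0\end{pmatrix}$. For $t\ne0$ they are DPW potentials on $\Sigma$ (at $t=0$ the potential is $0$): $\eta_t$ is a holomorphic $(1,0)$-form on $\Sigma$ with values in the real analytic loops in $\mathfrak{sl}(2,\mathbb C)$, $\lambda\eta_t$ extends holomorphically in $\lambda$ to the closed unit disc, and its value at $\lambda=0$ is nilpotent and nowhere zero on $\Sigma$. -/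

import Mathlib

open Complex Set Topology
open scoped ComplexConjugate

noncomputable section

namespace DPW

/-! ## Loops: the Wiener-type spaces `W_ρ` -/

/-- Fourier coefficients `(h_k)_{k ∈ ℤ}` of a loop `h = ∑ h_k λ^k`.  (A type synonym, so that no
product topology is attached to it.) -/
def Coeffs : Type := ℤ → ℂ

instance : AddCommGroup Coeffs := inferInstanceAs (AddCommGroup (ℤ → ℂ))
instance : Module ℝ Coeffs := inferInstanceAs (Module ℝ (ℤ → ℂ))

/-- The `k`-th Fourier coefficient. -/
def Coeffs.coeff (h : Coeffs) (k : ℤ) : ℂ := h k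

@[simp] theorem Coeffs.coeff_zero (k : ℤ) : (0 : Coeffs).coeff k = 0 := rfl
@[simp] theorem Coeffs.coeff_add (f g : Coeffs) (k : ℤ) :
    (f + g).coeff k = f.coeff k + g.coeff k := rfl
@[simp] theorem Coeffs.coeff_smul (r : ℝ) (f : Coeffs) (k : ℤ) :
    (r • f).coeff k = r • f.coeff k := rfl

/-- `W_ρ`: the loops with `∑ |h_k| ρ^|k| < ∞`, as a real vector space. -/
def W (ρ : ℝ) : Submodule ℝ Coeffs where
  carrier := {h | Summable fun k : ℤ => ‖h.coeff k‖ * |ρ| ^ k.natAbs}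
  zero_mem' := by
    simp
  add_mem' := by
    intro f g hf hg
    refine Summable.of_nonneg_of_le (fun k => by positivity) (fun k => ?_) (hf.add hg)
    rw [Coeffs.coeff_add, ← add_mul]
    exact mul_le_mul_of_nonneg_right (norm_add_le _ _) (by positivity)
  smul_mem' := by
    intro r f hf
    refine (hf.mul_left |r|).congr (fun k => ?_)
    rw [Coeffs.coeff_smul, norm_smul, Real.norm_eq_abs, mul_assoc]

/-- `‖h‖_ρ = ∑ |h_k| ρ^|k|`. -/
instance (ρ : ℝ) : Norm (W ρ) :=
  ⟨fun h => ∑' k : ℤ, ‖h.1.coeff k‖ * |ρ| ^ k.natAbs⟩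

theorem W.norm_def (ρ : ℝ) (h : W ρ) :
    ‖h‖ = ∑' k : ℤ, ‖h.1.coeff k‖ * |ρ| ^ k.natAbs := rfl

theorem W.core (ρ : ℝ) [hρ : Fact (1 < ρ)] : NormedSpace.Core ℝ (W ρ) where
  norm_nonneg h := tsum_nonneg fun k => by positivity
  norm_smul r h := by
    rw [W.norm_def, W.norm_def, Real.norm_eq_abs, ← tsum_mul_left]
    refine tsum_congr fun k => ?_
    rw [Submodule.coe_smul, Coeffs.coeff_smul, norm_smul, Real.norm_eq_abs, mul_assoc]
  norm_triangle f g := by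
    rw [W.norm_def, W.norm_def, W.norm_def, ← Summable.tsum_add f.2 g.2]
    refine Summable.tsum_le_tsum (fun k => ?_) (f + g).2 (f.2.add g.2)
    rw [Submodule.coe_add, Coeffs.coeff_add, ← add_mul]
    exact mul_le_mul_of_nonneg_right (norm_add_le _ _) (by positivity)
  norm_eq_zero_iff h := by
    have hpos : 0 < |ρ| := abs_pos.2 (by linarith [hρ.out])
    constructor
    · intro h0
      rw [W.norm_def] at h0
      have h1 := (hasSum_zero_iff_of_nonneg (fun k => by positivity)).1 (h0 ▸ h.2.hasSum)
      refine Subtype.ext (funext fun k => ?_)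
      have h2 : h.1.coeff k = 0 := by simpa [hpos.ne'] using congrFun h1 k
      exact h2
    · rintro rfl
      simp [W.norm_def]

instance (ρ : ℝ) [Fact (1 < ρ)] : NormedAddCommGroup (W ρ) :=
  NormedAddCommGroup.ofCore (W.core ρ)

instance (ρ : ℝ) [Fact (1 < ρ)] : NormedSpace ℝ (W ρ) :=
  NormedSpace.ofCore (W.core ρ)

/-- `W_{ℝ,ρ}^{≥0}`: only nonnegative powers of `λ`, and `h = \bar h` (where
`\bar h(λ) = conj (h (conj λ))` has coefficients `conj h_k`). -/
def WRNonneg (ρ : ℝ) : Submodule ℝ (W ρ) where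
  carrier := {h | (∀ k < 0, h.1.coeff k = 0) ∧ ∀ k, conj (h.1.coeff k) = h.1.coeff k}
  zero_mem' := by simp
  add_mem' := by
    rintro f g ⟨hf, hf'⟩ ⟨hg, hg'⟩
    exact ⟨fun k hk => by simp [hf k hk, hg k hk], fun k => by simp [hf' k, hg' k]⟩
  smul_mem' := by
    rintro r f ⟨hf, hf'⟩
    exact ⟨fun k hk => by simp [hf k hk], fun k => by simp [hf' k]⟩

/-- The value `h(λ) = ∑ h_k λ^k`. -/
def loopEval {ρ : ℝ} (h : WRNonneg ρ) (lam : ℂ) : ℂ := ∑' k : ℤ, h.1.1.coeff k * lam ^ k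

/-- `h^*(λ) = conj (h (1 / conj λ))`. -/
def starLoop (h : ℂ → ℂ) (lam : ℂ) : ℂ := conj (h (1 / conj lam))

/-! ## Parameters -/

/-- The parameter vector `x = (ã, b̃, c̃, r, θ)`, with the product norm. -/
abbrev Param (ρ : ℝ) : Type := WRNonneg ρ × WRNonneg ρ × WRNonneg ρ × ℝ × ℝ

/-- The central value `(0, 0, 0, 1, π/2)`. -/
def central (ρ : ℝ) : Param ρ := (0, 0, 0, 1, Real.pi / 2)

variable {ρ : ℝ}

/-- `r`. -/
def Param.r (x : Param ρ) : ℝ := x.2.2.2.1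
/-- `θ`. -/
def Param.θ (x : Param ρ) : ℝ := x.2.2.2.2

/-- `a = (λ⁻¹ - λ)/2 + ã`. -/
def Param.a (x : Param ρ) (lam : ℂ) : ℂ := 1 / 2 * (lam⁻¹ - lam) + loopEval x.1 lam
/-- `b = -sin φ (λ⁻¹ + λ)/2 + b̃`. -/
def Param.b (φ : ℝ) (x : Param ρ) (lam : ℂ) : ℂ :=
  -(1 / 2) * (Real.sin φ : ℂ) * (lam⁻¹ + lam) + loopEval x.2.1 lam
/-- `c = -cos φ (λ⁻¹ + λ)/2 + c̃`. -/
def Param.c (φ : ℝ) (x : Param ρ) (lam : ℂ) : ℂ :=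
  -(1 / 2) * (Real.cos φ : ℂ) * (lam⁻¹ + lam) + loopEval x.2.2.1 lam

/-! ## The potential -/

/-- Complex `2 × 2` matrices. -/
abbrev M2 : Type := Matrix (Fin 2) (Fin 2) ℂ

/-- The punctures `p₁, p₂, p₃, p₄` (indexed from `0`). -/
def punct (φ : ℝ) : Fin 4 → ℂ :=
  ![exp (I * φ), -exp (-(I * φ)), -exp (I * φ), exp (-(I * φ))]

/-- The residues `A₁, A₂, A₃, A₄` (indexed from `0`) built from `a, b, c`. -/
def residue (a b c : ℂ) : Fin 4 → M2 :=
  ![!![I * a, b + I * c; b - I * c, -(I * a)],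
    !![-(I * a), -b + I * c; -b - I * c, I * a],
    !![I * a, -b - I * c; -b + I * c, -(I * a)],
    !![-(I * a), b - I * c; b + I * c, I * a]]

/-- The coefficient `E(λ, z)` of the potential
`η = E dz = r t ∑_k A_k(λ) dz / (z - p_k)`. -/
def potential (φ t : ℝ) (x : Param ρ) (lam z : ℂ) : M2 :=
  ((x.r * t : ℝ) : ℂ) •
    ∑ k, (1 / (z - punct φ k)) • residue (x.a lam) (x.b φ lam) (x.c φ lam) k

/-- `E dz` is a DPW potential in a chart domain `U`: the loop `λ ↦ λ E(λ, z)` on the unit circle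
extends to a function `B(λ, z)`, holomorphic for `λ` in (a neighbourhood of) the closed unit disc
and `z ∈ U`, with values in `𝔰𝔩(2, ℂ)`, and its value `B(0, z)`, the residue of `E` at `λ = 0`,
vanishes nowhere and is nilpotent. -/
def IsDPWChart (U : Set ℂ) (E : ℂ → ℂ → M2) : Prop :=
  ∃ B : ℂ → ℂ → M2,
    (∀ i j, AnalyticOnNhd ℂ (fun q : ℂ × ℂ => B q.1 q.2 i j) (Metric.closedBall 0 1 ×ˢ U)) ∧
    (∀ lam ∈ Metric.sphere (0 : ℂ) 1, ∀ z ∈ U, B lam z = lam • E lam z) ∧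
    (∀ lam ∈ Metric.closedBall (0 : ℂ) 1, ∀ z ∈ U, (B lam z).trace = 0) ∧
    (∀ z ∈ U, B 0 z ≠ 0 ∧ IsNilpotent (B 0 z))

/-- `E dz` is a DPW potential on `Σ_φ = ℂP¹ \ {p₁, …, p₄}`, in the charts `z` and `w = 1/z`
(where `E(z) dz = -w⁻² E(1/w) dw`). -/
def IsDPWPotential (φ : ℝ) (E : ℂ → ℂ → M2) : Prop :=
  IsDPWChart (range (punct φ))ᶜ E ∧
  ∃ E' : ℂ → ℂ → M2,
    IsDPWChart {w | w = 0 ∨ w⁻¹ ∉ range (punct φ)} E' ∧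
    ∀ lam ∈ Metric.sphere (0 : ℂ) 1, ∀ w : ℂ, w ≠ 0 → w⁻¹ ∉ range (punct φ) →
      E' lam w = (-(w ^ 2)⁻¹) • E lam w⁻¹

/-- `D = diag(i, -i)`. -/
def matD : M2 := !![I, 0; 0, -I]
/-- `C = (0, i; i, 0)`. -/
def matC : M2 := !![0, I; I, 0]

/-- The symmetries of `η = E dz` under `δ(z) = -z`, `τ(z) = 1/z`, `σ(z) = conj z`:
`δ^* η = D⁻¹ η D`, `τ^* η = C⁻¹ η C`, `σ^* conj η(·, conj λ) = η(·, λ)`. -/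
structure IsSymmetric (φ : ℝ) (E : ℂ → ℂ → M2) : Prop where
  delta : ∀ lam ∈ Metric.sphere (0 : ℂ) 1, ∀ z ∉ range (punct φ),
    (-1 : ℂ) • E lam (-z) = matD⁻¹ * E lam z * matD
  tau : ∀ lam ∈ Metric.sphere (0 : ℂ) 1, ∀ z ∉ range (punct φ), z ≠ 0 →
    (-(z ^ 2)⁻¹) • E lam (1 / z) = matC⁻¹ * E lam z * matC
  sigma : ∀ lam ∈ Metric.sphere (0 : ℂ) 1, ∀ z ∉ range (punct φ),
    (E (conj lam) (conj z)).map conj = E lam z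

/-! ## The principal solutions and the monodromy problem -/

/-- `Y` is the solution of `dΦ = Φ E dz`, `Φ(0) = Id`, along the segment `s ↦ s v`, `0 ≤ s ≤ 1`. -/
def IsFrameAlong (E : ℂ → M2) (v : ℂ) (Y : ℝ → M2) : Prop :=
  Y 0 = 1 ∧ ∀ s ∈ Icc (0 : ℝ) 1, ∀ i j,
    HasDerivWithinAt (fun s => Y s i j) ((v • (Y s * E (s * v))) i j) (Icc 0 1) s

open Classical in
/-- The principal solution `Φ(v)`: the value at the endpoint `v` of the solution of `dΦ = Φ E dz`,
`Φ(0) = Id` along the segment from `0` to `v`.  This solution exists and is unique when `E` is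
continuous on the segment (the value `0` otherwise is immaterial). -/
def principal (E : ℂ → M2) (v : ℂ) : M2 :=
  if h : ∃ Y, IsFrameAlong E v Y then h.choose 1 else 0

/-- `𝔭 = P₁₁ P₂₁ - P₁₂ P₂₂` for `P = Φ(1)`. -/
def pFun (φ t : ℝ) (x : Param ρ) (lam : ℂ) : ℂ :=
  let P := principal (potential φ t x lam) 1
  P 0 0 * P 1 0 - P 0 1 * P 1 1

/-- `𝔮 = i (Q₁₁ Q₂₁ + Q₁₂ Q₂₂)` for `Q = Φ(i)`. -/
def qFun (φ t : ℝ) (x : Param ρ) (lam : ℂ) : ℂ :=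
  let Q := principal (potential φ t x lam) I
  I * (Q 0 0 * Q 1 0 + Q 0 1 * Q 1 1)

/-- `\hat 𝔭(t) = (𝔭(t) - 𝔭(0)) / t` for `t ≠ 0`, and `𝔭'(0)` for `t = 0`. -/
def pHat (φ t : ℝ) (x : Param ρ) (lam : ℂ) : ℂ :=
  dslope (fun s : ℝ => pFun φ s x lam) 0 t

/-- `\hat 𝔮`, likewise. -/
def qHat (φ t : ℝ) (x : Param ρ) (lam : ℂ) : ℂ :=
  dslope (fun s : ℝ => qFun φ s x lam) 0 t

/-- `F = \hat 𝔭 - \hat 𝔭^*`. -/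
def calF (φ t : ℝ) (x : Param ρ) (lam : ℂ) : ℂ :=
  pHat φ t x lam - starLoop (pHat φ t x) lam

/-- `G = \hat 𝔮 - \hat 𝔮^*`. -/
def calG (φ t : ℝ) (x : Param ρ) (lam : ℂ) : ℂ :=
  qHat φ t x lam - starLoop (qHat φ t x) lam

/-- `K = det (r A₁)`. -/
def calK (φ : ℝ) (x : Param ρ) (lam : ℂ) : ℂ :=
  ((x.r : ℂ) • residue (x.a lam) (x.b φ lam) (x.c φ lam) 0).det

/-- `H₁ = \hat 𝔭(e^{iθ})`. -/
def calH₁ (φ t : ℝ) (x : Param ρ) : ℂ := pHat φ t x (exp (I * x.θ))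

/-- `H₂ = \hat 𝔮(e^{iθ})`. -/
def calH₂ (φ t : ℝ) (x : Param ρ) : ℂ := qHat φ t x (exp (I * x.θ))

/-- The reformulated monodromy problem for the potential with parameters `(φ, t, x)`; equalities
between loops are equalities on the unit circle. -/
structure SolvesMonodromyProblem (φ t : ℝ) (x : Param ρ) : Prop where
  F_eq : ∀ lam ∈ Metric.sphere (0 : ℂ) 1, calF φ t x lam = 0
  G_eq : ∀ lam ∈ Metric.sphere (0 : ℂ) 1, calG φ t x lam = 0
  K_eq : ∀ lam ∈ Metric.sphere (0 : ℂ) 1, calK φ x lam = -1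
  θ_mem : x.θ ∈ Ioo 0 Real.pi
  H₁_eq : calH₁ φ t x = 0
  H₂_eq : calH₂ φ t x = 0

end DPW

end

/-!
Summing over the four poles, the potential is a combination of `a, b, c` whose coefficients are
rational in `z`. Along the segments from `0` to `1` and from `0` to `i` these coefficients are real,
on the second one after conjugation by a constant diagonal matrix. Hence `dΦ = Φ η` can be solved
over the commutative Banach algebra of loops with real Fourier coefficients, where the solution is
analytic in `(t, x)`. At `t = 0` the frame is the identity, so `\hat 𝔭` and `\hat 𝔮` are again loops
analytic in `(t, x)`, equal to `2 π r c` and `2 π r b` at `t = 0`.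

Since `𝒦 + 1` has at most a simple pole at `λ = 0`, the monodromy problem becomes the vanishing of
an analytic map from a neighbourhood of `(0, central ρ)` to `Param ρ`. Its derivative in `x` is
invertible: `ℱ` and `𝒢` determine the variations of `c̃` and `b̃` up to their constant terms,
division by `1 - λ²` with a remainder of degree one determines those of `ã` and `r` and a relation
between the two constants, and `ℋ₁`, `ℋ₂` leave a linear system with determinant `sin² φ + cos² φ`
for the constants and the variation of `θ`. The implicit function theorem applies.
-/

noncomputable section

namespace DPW

/-! ## The Banach algebra of loops with real Fourier coefficients -/

/-- The weight `ρ^|k|` of the norm of `W ρ`. -/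
def weight (ρ : ℝ) (k : ℤ) : ℝ := |ρ| ^ k.natAbs

section Weight

variable (ρ : ℝ) [hρ : Fact (1 < ρ)]

theorem one_lt_abs_of_fact : 1 < |ρ| :=
  hρ.out.trans_le (le_abs_self ρ)

theorem one_le_weight (k : ℤ) : 1 ≤ weight ρ k :=
  one_le_pow₀ (one_lt_abs_of_fact ρ).le

theorem weight_pos (k : ℤ) : 0 < weight ρ k :=
  one_pos.trans_le (one_le_weight ρ k)

theorem weight_add_le (j k : ℤ) : weight ρ (j + k) ≤ weight ρ j * weight ρ k := by
  rw [weight, weight, weight, ← pow_add]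
  exact pow_le_pow_right₀ (one_lt_abs_of_fact ρ).le (Int.natAbs_add_le j k)

theorem abs_mul_weight_nonneg (c : ℝ) (k : ℤ) : 0 ≤ |c| * weight ρ k :=
  mul_nonneg (abs_nonneg c) (weight_pos ρ k).le

end Weight

theorem weight_neg (ρ : ℝ) (k : ℤ) : weight ρ (-k) = weight ρ k := by
  rw [weight, weight, Int.natAbs_neg]

theorem summable_pow_natAbs {q : ℝ} (h0 : 0 ≤ q) (h1 : q < 1) :
    Summable fun k : ℤ => q ^ k.natAbs := by
  rw [summable_int_iff_summable_nat_and_neg]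
  simpa using summable_geometric_of_lt_one h0 h1

theorem norm_zpow_le_pow_natAbs {z : ℂ} {R : ℝ} (hR : 0 < R) (h1 : R⁻¹ ≤ ‖z‖) (h2 : ‖z‖ ≤ R)
    (k : ℤ) : ‖z ^ k‖ ≤ R ^ k.natAbs := by
  have hz : 0 < ‖z‖ := (inv_pos.2 hR).trans_le h1
  rw [norm_zpow]
  obtain ⟨n, rfl | rfl⟩ := k.eq_nat_or_neg
  · simpa using pow_le_pow_left₀ hz.le h2 n
  · have : ‖z‖⁻¹ ≤ R := inv_le_of_inv_le₀ hR h1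
    simpa [← inv_pow] using pow_le_pow_left₀ (inv_nonneg.2 hz.le) this n

theorem coeff_eq_zero_of_hasSum_zero {c : ℤ → ℂ} (hc : Summable fun k => ‖c k‖)
    (h : ∀ z : ℂ, ‖z‖ = 1 → HasSum (fun k => c k * z ^ k) 0) (n : ℤ) : c n = 0 := by
  have hs : Summable fun k => c k • (fourier k : C(UnitAddCircle, ℂ)) := by
    refine Summable.of_norm (hc.congr fun k => ?_)
    rw [norm_smul, fourier_norm, mul_one]
  have h_uniform : HasSum (fun k => c k • (fourier k : C(UnitAddCircle, ℂ))) 0 := by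
    have h_tsum : ∑' k, c k • (fourier k : C(UnitAddCircle, ℂ)) = 0 := by
      ext x
      refine ((ContinuousMap.evalCLM ℂ x).hasSum hs.hasSum).unique ?_
      refine (h (AddCircle.toCircle x : ℂ) (Circle.norm_coe _)).congr_fun fun k => ?_
      simp [fourier_apply, AddCircle.toCircle_zsmul]
    exact h_tsum ▸ hs.hasSum
  have h_inner := ((innerSL ℂ (fourierLp (T := 1) 2 n)) ∘L
    (ContinuousMap.toLp 2 AddCircle.haarAddCircle ℂ)).hasSum h_uniform
  rw [map_zero] at h_inner
  refine (hasSum_ite_eq n (c n)).unique (h_inner.congr_fun fun k => ?_)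
  have h_orth := orthonormal_iff_ite.1 (orthonormal_fourier (T := 1)) n k
  simp only [fourierLp] at h_orth
  by_cases hk : k = n
  · subst hk
    simp [-inner_self_eq_norm_sq_to_K, h_orth]
  · simp [h_orth, hk, Ne.symm hk]

/-- Loops `∑ h_k λ^k` with `h_k ∈ ℝ` and `∑ |h_k| ρ^|k| < ∞`.  A loop is stored as the sequence
`h_k ρ^|k|` of `ℓ¹`, from which the Banach space structure is inherited. -/
def RealLoop (_ρ : ℝ) : Type := lp (fun _ : ℤ => ℝ) 1

namespace RealLoop

variable {ρ : ℝ}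

instance : NormedAddCommGroup (RealLoop ρ) := inferInstanceAs (NormedAddCommGroup (lp _ 1))
instance : NormedSpace ℝ (RealLoop ρ) := inferInstanceAs (NormedSpace ℝ (lp (fun _ : ℤ => ℝ) 1))
instance : CompleteSpace (RealLoop ρ) := inferInstanceAs (CompleteSpace (lp (fun _ : ℤ => ℝ) 1))

/-- The `k`-th Fourier coefficient. -/
def coeff (f : RealLoop ρ) (k : ℤ) : ℝ := (show lp (fun _ : ℤ => ℝ) 1 from f) k / weight ρ k

@[simp] theorem coeff_zero (k : ℤ) : (0 : RealLoop ρ).coeff k = 0 := zero_div _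

@[simp] theorem coeff_add (f g : RealLoop ρ) (k : ℤ) : (f + g).coeff k = f.coeff k + g.coeff k :=
  add_div _ _ _

@[simp] theorem coeff_sub (f g : RealLoop ρ) (k : ℤ) : (f - g).coeff k = f.coeff k - g.coeff k :=
  sub_div _ _ _

@[simp] theorem coeff_smul (r : ℝ) (f : RealLoop ρ) (k : ℤ) : (r • f).coeff k = r * f.coeff k :=
  mul_div_assoc _ _ _

variable [hρ : Fact (1 < ρ)]

theorem coeff_mul_weight (f : RealLoop ρ) (k : ℤ) :
    f.coeff k * weight ρ k = (show lp (fun _ : ℤ => ℝ) 1 from f) k :=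
  div_mul_cancel₀ _ (weight_pos ρ k).ne'

@[ext] theorem ext {f g : RealLoop ρ} (h : ∀ k, f.coeff k = g.coeff k) : f = g := by
  refine lp.ext (funext fun k => ?_)
  exact (coeff_mul_weight f k).symm.trans
    ((congrArg (· * weight ρ k) (h k)).trans (coeff_mul_weight g k))

theorem summable_coeff (f : RealLoop ρ) : Summable fun k => |f.coeff k| * weight ρ k := by
  have h := (memℓp_gen_iff (p := 1) (by simp)).1 (lp.memℓp (show lp (fun _ : ℤ => ℝ) 1 from f))
  refine h.congr fun k => ?_
  rw [← coeff_mul_weight]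
  simp [abs_of_pos (weight_pos ρ k)]

theorem norm_eq_tsum (f : RealLoop ρ) : ‖f‖ = ∑' k, |f.coeff k| * weight ρ k := by
  refine (lp.norm_eq_tsum_rpow (p := 1) (by simp) (show lp (fun _ : ℤ => ℝ) 1 from f)).trans ?_
  simp only [ENNReal.toReal_one, Real.rpow_one, div_one]
  refine tsum_congr fun k => ?_
  rw [← coeff_mul_weight]
  simp [abs_of_pos (weight_pos ρ k)]

/-- The loop with given coefficients. -/
def ofCoeff (c : ℤ → ℝ) (hc : Summable fun k => |c k| * weight ρ k) : RealLoop ρ :=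
  (⟨fun k => c k * weight ρ k, memℓp_gen (by
    refine hc.congr fun k => ?_
    simp [abs_of_pos (weight_pos ρ k)])⟩ : lp (fun _ : ℤ => ℝ) 1)

@[simp] theorem coeff_ofCoeff (c : ℤ → ℝ) (hc : Summable fun k => |c k| * weight ρ k) (k : ℤ) :
    (ofCoeff c hc).coeff k = c k :=
  mul_div_cancel_right₀ _ (weight_pos ρ k).ne'

theorem abs_coeff_le (f : RealLoop ρ) (k : ℤ) : |f.coeff k| ≤ (weight ρ k)⁻¹ * ‖f‖ := by
  rw [inv_mul_eq_div, le_div_iff₀ (weight_pos ρ k), norm_eq_tsum]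
  exact f.summable_coeff.le_tsum k fun j _ => abs_mul_weight_nonneg ρ _ j

/-- The `k`-th coefficient as a continuous linear map with values in `ℂ`. -/
def coeffCLM (k : ℤ) : RealLoop ρ →L[ℝ] ℂ :=
  LinearMap.mkContinuous
    { toFun := fun f => (f.coeff k : ℂ)
      map_add' := fun f g => by simp
      map_smul' := fun r f => by simp } (weight ρ k)⁻¹
    fun f => by simpa using f.abs_coeff_le k

@[simp] theorem coeffCLM_apply (k : ℤ) (f : RealLoop ρ) : coeffCLM k f = (f.coeff k : ℂ) := rfl

/-! ### Evaluation on the unit circle -/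

/-- Evaluation `h ↦ h(z)`.  For `z` off the closed annulus `ρ⁻¹ ≤ |z| ≤ ρ` the sum may diverge and
the value is then immaterial. -/
def eval (z : ℂ) : RealLoop ρ →L[ℝ] ℂ := ∑' k : ℤ, z ^ k • coeffCLM k

theorem norm_zpow_smul_coeffCLM_le {z : ℂ} {R : ℝ} (hR : 0 < R) (h1 : R⁻¹ ≤ ‖z‖) (h2 : ‖z‖ ≤ R)
    (k : ℤ) : ‖z ^ k • (coeffCLM k : RealLoop ρ →L[ℝ] ℂ)‖ ≤ (R / |ρ|) ^ k.natAbs := by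
  have h_coeff : ‖(coeffCLM k : RealLoop ρ →L[ℝ] ℂ)‖ ≤ (weight ρ k)⁻¹ :=
    LinearMap.mkContinuous_norm_le _ (inv_nonneg.2 (weight_pos ρ k).le) _
  rw [norm_smul, div_pow, div_eq_mul_inv]
  exact mul_le_mul (norm_zpow_le_pow_natAbs hR h1 h2 k) h_coeff (norm_nonneg _) (by positivity)

theorem summable_eval {z : ℂ} (hz : ‖z‖ = 1) :
    Summable fun k : ℤ => z ^ k • (coeffCLM k : RealLoop ρ →L[ℝ] ℂ) :=
  Summable.of_norm_bounded (summable_pow_natAbs (by positivity)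
      ((div_lt_one₀ (one_pos.trans (one_lt_abs_of_fact ρ))).2 (one_lt_abs_of_fact ρ)))
    fun k => norm_zpow_smul_coeffCLM_le one_pos (by simp [hz]) hz.le k

theorem hasSum_eval {z : ℂ} (hz : ‖z‖ = 1) (f : RealLoop ρ) :
    HasSum (fun k : ℤ => (f.coeff k : ℂ) * z ^ k) (eval z f) := by
  refine ((ContinuousLinearMap.apply ℝ ℂ f).hasSum (summable_eval hz).hasSum).congr_fun fun k => ?_
  simp [mul_comm]

theorem summable_norm_eval {z : ℂ} (hz : ‖z‖ = 1) (f : RealLoop ρ) :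
    Summable fun k : ℤ => ‖(f.coeff k : ℂ) * z ^ k‖ := by
  refine Summable.of_nonneg_of_le (fun k => norm_nonneg _) (fun k => ?_) f.summable_coeff
  rw [norm_mul, norm_zpow, hz, one_zpow, Complex.norm_real, Real.norm_eq_abs]
  exact mul_le_mul_of_nonneg_left (one_le_weight ρ k) (abs_nonneg _)

theorem ext_of_eval {f g : RealLoop ρ} (h : ∀ z : ℂ, ‖z‖ = 1 → eval z f = eval z g) : f = g := by
  refine ext fun k => sub_eq_zero.1 ?_
  have hk := coeff_eq_zero_of_hasSum_zero (c := fun k => ((f - g).coeff k : ℂ))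
    (by simpa using summable_norm_eval norm_one (f - g))
    (fun z hz => by simpa [h z hz] using hasSum_eval hz (f - g)) k
  simpa using ofReal_eq_zero.1 hk

theorem analyticAt_eval {z : ℂ} (hz : ‖z‖ = 1) :
    AnalyticAt ℂ (fun w : ℂ => (eval w : RealLoop ρ →L[ℝ] ℂ)) z := by
  obtain ⟨R, hR1, hR2⟩ := exists_between (one_lt_abs_of_fact ρ)
  have hR0 : 0 < R := one_pos.trans hR1
  let U : Set ℂ := {w | R⁻¹ < ‖w‖ ∧ ‖w‖ < R}
  have hU : IsOpen U :=
    (isOpen_lt continuous_const continuous_norm).inter (isOpen_lt continuous_norm continuous_const)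
  have hzU : z ∈ U := ⟨by rw [hz]; exact inv_lt_one_of_one_lt₀ hR1, by rw [hz]; exact hR1⟩
  have hd : DifferentiableOn ℂ (fun w : ℂ => (eval w : RealLoop ρ →L[ℝ] ℂ)) U := by
    refine differentiableOn_tsum_of_summable_norm
      (summable_pow_natAbs (by positivity) ((div_lt_one₀ (hR0.trans hR2)).2 hR2))
      (fun k w hw => ?_) hU (fun k w hw => norm_zpow_smul_coeffCLM_le hR0 hw.1.le hw.2.le k)
    have hw0 : w ≠ 0 := norm_pos_iff.1 ((inv_pos.2 hR0).trans hw.1)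
    exact ((differentiableAt_zpow.2 (Or.inl hw0)).smul_const _).differentiableWithinAt
  exact hd.analyticAt (hU.mem_nhds hzU)

/-! ### The product -/

/-- The change of summation variables `(k, j) ↦ (j, k - j)` of the Cauchy product. -/
def convEquiv : ℤ × ℤ ≃ ℤ × ℤ where
  toFun q := (q.2, q.1 - q.2)
  invFun q := (q.1 + q.2, q.1)
  left_inv q := by simp
  right_inv q := by simp

theorem summable_coeff_prod (f g : RealLoop ρ) : Summable fun q : ℤ × ℤ =>
    (|f.coeff q.1| * weight ρ q.1) * (|g.coeff q.2| * weight ρ q.2) :=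
  f.summable_coeff.mul_of_nonneg g.summable_coeff
    (fun k => abs_mul_weight_nonneg ρ _ k) fun k => abs_mul_weight_nonneg ρ _ k

theorem summable_conv (f g : RealLoop ρ) : Summable fun q : ℤ × ℤ =>
    (|f.coeff q.2| * weight ρ q.2) * (|g.coeff (q.1 - q.2)| * weight ρ (q.1 - q.2)) :=
  convEquiv.summable_iff.2 (summable_coeff_prod f g)

theorem abs_mul_coeff_mul_weight_le (f g : RealLoop ρ) (k j : ℤ) :
    |f.coeff j * g.coeff (k - j)| * weight ρ k ≤
      (|f.coeff j| * weight ρ j) * (|g.coeff (k - j)| * weight ρ (k - j)) := by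
  have h := weight_add_le ρ j (k - j)
  rw [add_sub_cancel] at h
  rw [abs_mul, mul_mul_mul_comm]
  exact mul_le_mul_of_nonneg_left h (by positivity)

theorem summable_abs_conv (f g : RealLoop ρ) (k : ℤ) :
    Summable fun j => |f.coeff j * g.coeff (k - j)| := by
  refine Summable.of_nonneg_of_le (fun j => abs_nonneg _) (fun j => ?_)
    ((summable_conv f g).prod_factor k)
  exact (le_mul_of_one_le_right (abs_nonneg _) (one_le_weight ρ k)).trans
    (abs_mul_coeff_mul_weight_le f g k j)

theorem abs_conv_mul_weight_le (f g : RealLoop ρ) (k : ℤ) :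
    |∑' j, f.coeff j * g.coeff (k - j)| * weight ρ k ≤
      ∑' j, (|f.coeff j| * weight ρ j) * (|g.coeff (k - j)| * weight ρ (k - j)) := by
  have h_tri : |∑' j, f.coeff j * g.coeff (k - j)| ≤ ∑' j, |f.coeff j * g.coeff (k - j)| := by
    simpa only [Real.norm_eq_abs] using
      norm_tsum_le_tsum_norm (f := fun j => f.coeff j * g.coeff (k - j)) (summable_abs_conv f g k)
  calc |∑' j, f.coeff j * g.coeff (k - j)| * weight ρ k
      ≤ (∑' j, |f.coeff j * g.coeff (k - j)|) * weight ρ k :=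
        mul_le_mul_of_nonneg_right h_tri (weight_pos ρ k).le
    _ = ∑' j, |f.coeff j * g.coeff (k - j)| * weight ρ k := tsum_mul_right.symm
    _ ≤ _ := Summable.tsum_le_tsum (fun j => abs_mul_coeff_mul_weight_le f g k j)
        ((summable_abs_conv f g k).mul_right _) ((summable_conv f g).prod_factor k)

instance : Mul (RealLoop ρ) :=
  ⟨fun f g => ofCoeff (fun k => ∑' j, f.coeff j * g.coeff (k - j))
    (Summable.of_nonneg_of_le (fun k => abs_mul_weight_nonneg ρ _ k)
      (fun k => abs_conv_mul_weight_le f g k) (summable_conv f g).prod)⟩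

theorem coeff_mul (f g : RealLoop ρ) (k : ℤ) :
    (f * g).coeff k = ∑' j, f.coeff j * g.coeff (k - j) :=
  coeff_ofCoeff _ _ _

theorem norm_mul_le_mul_norm (f g : RealLoop ρ) : ‖f * g‖ ≤ ‖f‖ * ‖g‖ := by
  rw [norm_eq_tsum f, norm_eq_tsum g,
    f.summable_coeff.tsum_mul_tsum g.summable_coeff (summable_coeff_prod f g),
    ← convEquiv.tsum_eq, norm_eq_tsum]
  refine le_of_le_of_eq ?_ (summable_conv f g).tsum_prod.symm
  refine Summable.tsum_le_tsum (fun k => ?_) (f * g).summable_coeff (summable_conv f g).prod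
  rw [coeff_mul]
  exact abs_conv_mul_weight_le f g k

theorem eval_mul {z : ℂ} (hz : ‖z‖ = 1) (f g : RealLoop ρ) :
    eval z (f * g) = eval z f * eval z g := by
  have hz0 : z ≠ 0 := norm_pos_iff.1 (hz ▸ one_pos)
  have hs := summable_mul_of_summable_norm (summable_norm_eval hz f) (summable_norm_eval hz g)
  rw [← (hasSum_eval hz f).tsum_eq, ← (hasSum_eval hz g).tsum_eq,
    tsum_mul_tsum_of_summable_norm (summable_norm_eval hz f) (summable_norm_eval hz g),
    ← convEquiv.tsum_eq, ← (hasSum_eval hz (f * g)).tsum_eq]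
  refine Eq.trans (tsum_congr fun k => ?_) (convEquiv.summable_iff.2 hs).tsum_prod.symm
  rw [coeff_mul, ofReal_tsum, ← tsum_mul_right]
  refine tsum_congr fun j => ?_
  have : z ^ k = z ^ j * z ^ (k - j) := by rw [← zpow_add₀ hz0, add_sub_cancel]
  simp only [convEquiv, Equiv.coe_fn_mk, ofReal_mul, this, Function.comp_apply]
  ring

/-- The monomial `λ^n`. -/
def monomial (n : ℤ) : RealLoop ρ :=
  ofCoeff (Pi.single n 1) (summable_of_ne_finset_zero (s := {n}) fun k hk => by
    simp [Pi.single_eq_of_ne (Finset.notMem_singleton.1 hk)])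

@[simp] theorem coeff_monomial (n k : ℤ) :
    (monomial n : RealLoop ρ).coeff k = (Pi.single n 1 : ℤ → ℝ) k :=
  coeff_ofCoeff _ _ _

@[simp] theorem eval_monomial {z : ℂ} (hz : ‖z‖ = 1) (n : ℤ) :
    eval z (monomial n : RealLoop ρ) = z ^ n := by
  refine (hasSum_eval hz _).unique ?_
  convert hasSum_ite_eq n (z ^ n) using 2 with k
  by_cases hk : k = n
  · subst hk; simp
  · simp [hk]

instance : One (RealLoop ρ) := ⟨monomial 0⟩

theorem one_eq_monomial : (1 : RealLoop ρ) = monomial 0 := rfl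

theorem eval_one {z : ℂ} (hz : ‖z‖ = 1) : eval z (1 : RealLoop ρ) = 1 := by
  rw [one_eq_monomial, eval_monomial hz, zpow_zero]

-- Evaluations on the circle are multiplicative and separate loops, so the axioms hold as in `ℂ`.
instance : CommRing (RealLoop ρ) :=
  { (inferInstance : AddCommGroup (RealLoop ρ)) with
    mul := (· * ·)
    one := 1
    left_distrib := fun f g h => ext_of_eval fun z hz => by
      simp only [map_add, eval_mul hz, mul_add]
    right_distrib := fun f g h => ext_of_eval fun z hz => by
      simp only [map_add, eval_mul hz, add_mul]
    zero_mul := fun f => ext_of_eval fun z hz => by simp only [map_zero, eval_mul hz, zero_mul]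
    mul_zero := fun f => ext_of_eval fun z hz => by simp only [map_zero, eval_mul hz, mul_zero]
    mul_assoc := fun f g h => ext_of_eval fun z hz => by simp only [eval_mul hz, mul_assoc]
    one_mul := fun f => ext_of_eval fun z hz => by simp only [eval_mul hz, eval_one hz, one_mul]
    mul_one := fun f => ext_of_eval fun z hz => by simp only [eval_mul hz, eval_one hz, mul_one]
    mul_comm := fun f g => ext_of_eval fun z hz => by simp only [eval_mul hz, mul_comm] }

instance : NormedCommRing (RealLoop ρ) :=
  { (inferInstance : NormedAddCommGroup (RealLoop ρ)), (inferInstance : CommRing (RealLoop ρ)) with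
    norm_mul_le := norm_mul_le_mul_norm }

instance : NormedAlgebra ℝ (RealLoop ρ) :=
  { Algebra.ofModule (R := ℝ) (A := RealLoop ρ)
      (fun r f g => ext_of_eval fun z hz => by simp only [map_smul, eval_mul hz, smul_mul_assoc])
      (fun r f g => ext_of_eval fun z hz => by
        simp only [map_smul, eval_mul hz, mul_smul_comm]) with
    norm_smul_le := norm_smul_le }

theorem monomial_mul_monomial (m n : ℤ) :
    (monomial m * monomial n : RealLoop ρ) = monomial (m + n) :=
  ext_of_eval fun z hz => by
    simp only [eval_mul hz, eval_monomial hz, zpow_add₀ (norm_pos_iff.1 (hz ▸ one_pos))]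

theorem coeff_monomial_mul (n : ℤ) (f : RealLoop ρ) (k : ℤ) :
    (monomial n * f).coeff k = f.coeff (k - n) := by
  rw [coeff_mul, tsum_eq_single n fun j hj => by simp [hj]]
  simp

/-! ### Reversal -/

theorem summable_coeff_neg (f : RealLoop ρ) :
    Summable fun k => |f.coeff (-k)| * weight ρ k :=
  ((Equiv.neg ℤ).summable_iff.2 f.summable_coeff).congr fun k => by simp [weight_neg]

/-- The reversal `∑ h_k λ^k ↦ ∑ h_{-k} λ^k`.  On loops with real coefficients it is the involution
`h ↦ h^*`, which on the unit circle is complex conjugation of the values. -/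
def reverse : RealLoop ρ →L[ℝ] RealLoop ρ :=
  LinearMap.mkContinuous
    { toFun := fun f => ofCoeff (fun k => f.coeff (-k)) f.summable_coeff_neg
      map_add' := fun f g => ext fun k => by simp
      map_smul' := fun r f => ext fun k => by simp } 1
    fun f => by
      rw [one_mul, norm_eq_tsum, norm_eq_tsum, ← (Equiv.neg ℤ).tsum_eq]
      exact (tsum_congr fun k => by simp [weight_neg]).le

@[simp] theorem coeff_reverse (f : RealLoop ρ) (k : ℤ) : (reverse f).coeff k = f.coeff (-k) :=
  coeff_ofCoeff _ f.summable_coeff_neg _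

theorem eval_reverse {z : ℂ} (hz : ‖z‖ = 1) (f : RealLoop ρ) :
    eval z (reverse f) = conj (eval z f) := by
  refine (hasSum_eval hz _).unique ?_
  refine ((Equiv.neg ℤ).hasSum_iff.2 (hasSum_conj'.2 (hasSum_eval hz f))).congr_fun fun k => ?_
  simp [(Complex.inv_eq_conj hz).symm]

end RealLoop

section ODE

open scoped unitInterval ContDiff BoundedContinuousFunction

/-! ## Linear differential equations depending analytically on parameters -/

/-- The Banach space of continuous paths `[0, 1] → E`.  It is encoded by bounded continuous
functions, whose topology is by definition that of the supremum norm. -/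
abbrev PathSpace (E : Type*) [NormedAddCommGroup E] : Type _ := I →ᵇ E

section Primitive

variable {E : Type*} [NormedAddCommGroup E]

theorem continuous_IccExtend (f : PathSpace E) : Continuous (IccExtend zero_le_one f) :=
  f.continuous.Icc_extend'

variable [NormedSpace ℝ E]

/-- The primitive vanishing at `0` of a function on the unit interval, extended by constants. -/
def primitive (f : PathSpace E) (s : ℝ) : E := ∫ u in (0 : ℝ)..s, IccExtend zero_le_one f u

theorem primitive_zero (f : PathSpace E) : primitive f 0 = 0 := intervalIntegral.integral_same

theorem primitive_add (f g : PathSpace E) (s : ℝ) :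
    primitive (f + g) s = primitive f s + primitive g s :=
  intervalIntegral.integral_add ((continuous_IccExtend f).intervalIntegrable 0 s)
    ((continuous_IccExtend g).intervalIntegrable 0 s)

theorem primitive_smul (r : ℝ) (f : PathSpace E) (s : ℝ) :
    primitive (r • f) s = r • primitive f s :=
  intervalIntegral.integral_smul r _

theorem norm_primitive_le (f : PathSpace E) (s : I) : ‖primitive f s‖ ≤ ‖f‖ := by
  have h := intervalIntegral.norm_integral_le_of_norm_le_const (a := 0) (b := (s : ℝ))
    (f := IccExtend zero_le_one f) (C := ‖f‖) fun u _ => f.norm_coe_le_norm _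
  refine h.trans (mul_le_of_le_one_right (norm_nonneg _) ?_)
  rw [sub_zero, abs_of_nonneg s.2.1]
  exact s.2.2

variable [CompleteSpace E]

theorem hasDerivAt_primitive (f : PathSpace E) (s : ℝ) :
    HasDerivAt (primitive f) (IccExtend zero_le_one f s) s :=
  ((continuous_IccExtend f).integral_hasStrictDerivAt 0 s).hasDerivAt

/-- The integration operator `f ↦ ∫₀ f` on `C([0, 1], E)`. -/
def primitiveCLM : PathSpace E →L[ℝ] PathSpace E :=
  LinearMap.mkContinuous
    { toFun := fun f => BoundedContinuousFunction.mkOfCompact ⟨fun s => primitive f s,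
        (continuous_iff_continuousAt.2 fun s => (hasDerivAt_primitive f s).continuousAt).comp
          continuous_subtype_val⟩
      map_add' := fun f g => BoundedContinuousFunction.ext fun s : I => primitive_add f g s
      map_smul' := fun r f => BoundedContinuousFunction.ext fun s : I => primitive_smul r f s } 1
    fun f => by
      rw [one_mul]
      exact (BoundedContinuousFunction.norm_le (norm_nonneg f)).2 (norm_primitive_le f)

end Primitive

section Tensor

variable {E : Type*} [NormedAddCommGroup E] [NormedSpace ℝ E]

/-- The map `m ↦ (s ↦ α(s) m)`. -/
def tensor (α : PathSpace ℝ) : E →L[ℝ] PathSpace E :=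
  LinearMap.mkContinuous
    { toFun := fun m =>
        BoundedContinuousFunction.mkOfCompact ⟨fun s => α s • m, by fun_prop⟩
      map_add' := fun m n => BoundedContinuousFunction.ext fun s => smul_add (α s) m n
      map_smul' := fun r m => BoundedContinuousFunction.ext fun s => smul_comm (α s) r m } ‖α‖
    fun m => (BoundedContinuousFunction.norm_le (by positivity)).2 fun s =>
      (norm_smul_le _ _).trans
        (mul_le_mul_of_nonneg_right (α.norm_coe_le_norm s) (norm_nonneg _))

@[simp] theorem tensor_apply (α : PathSpace ℝ) (m : E) (s : I) : tensor α m s = α s • m := rfl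

theorem primitive_tensor [CompleteSpace E] (α : PathSpace ℝ) (m : E) (s : ℝ) :
    primitive (tensor α m) s = primitive α s • m :=
  intervalIntegral.integral_smul_const (IccExtend zero_le_one α) m

/-- The operator `y ↦ (s ↦ α(s) B(f, y(s)))` on paths, as a linear function of `f`. -/
def pointwise {F : Type*} [NormedAddCommGroup F] [NormedSpace ℝ F] (α : PathSpace ℝ)
    (B : F →L[ℝ] E →L[ℝ] E) : F →L[ℝ] PathSpace E →L[ℝ] PathSpace E :=
  LinearMap.mkContinuous₂
    (LinearMap.mk₂ ℝ
      (fun f y => BoundedContinuousFunction.mkOfCompact ⟨fun s => α s • B f (y s), by fun_prop⟩)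
      (fun f g y => BoundedContinuousFunction.ext fun s => by simp)
      (fun r f y => BoundedContinuousFunction.ext fun s => by simp [smul_comm r])
      (fun f y z => BoundedContinuousFunction.ext fun s => by simp)
      (fun r f y => BoundedContinuousFunction.ext fun s => by simp [smul_comm r]))
    (‖α‖ * ‖B‖)
    fun f y => (BoundedContinuousFunction.norm_le (by positivity)).2 fun s => by
      rw [mul_assoc, mul_assoc, ← mul_assoc ‖B‖]
      refine (norm_smul_le _ _).trans
        (mul_le_mul (α.norm_coe_le_norm s) ?_ (norm_nonneg _) (norm_nonneg _))
      exact (B.le_opNorm₂ f (y s)).trans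
        (mul_le_mul_of_nonneg_left (y.norm_coe_le_norm s) (by positivity))

end Tensor

section LinearODE

variable {E : Type*} [NormedAddCommGroup E] [NormedSpace ℝ E] [CompleteSpace E]

/-- The operator `1 - t ∫₀ L` whose invertibility makes the equation `y' = t L y` uniquely solvable
for every initial value. -/
def volterra (t : ℝ) (L : PathSpace E →L[ℝ] PathSpace E) : PathSpace E →L[ℝ] PathSpace E :=
  1 - t • (primitiveCLM ∘L L)

/-- The solution of `y' = t L y`, `y(0) = e` on the unit interval, when `volterra t L` is invertible
(and `0` otherwise). -/
def odeSol (t : ℝ) (L : PathSpace E →L[ℝ] PathSpace E) (e : E) : PathSpace E :=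
  Ring.inverse (volterra t L) (BoundedContinuousFunction.const I e)

/-- The quotient `(y(1) - e) / t` for the solution of `y' = t L y`, `y(0) = e`.  At `t = 0` it is
the derivative of `y(1)` with respect to `t`. -/
def odeQuot (t : ℝ) (L : PathSpace E →L[ℝ] PathSpace E) (e : E) : E :=
  primitive (L (odeSol t L e)) 1

/-- The solution of `y' = t L y`, `y(0) = e` as a function on the real line. -/
def odeFrame (t : ℝ) (L : PathSpace E →L[ℝ] PathSpace E) (e : E) (s : ℝ) : E :=
  e + t • primitive (L (odeSol t L e)) s

theorem odeFrame_zero (t : ℝ) (L : PathSpace E →L[ℝ] PathSpace E) (e : E) :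
    odeFrame t L e 0 = e := by
  rw [odeFrame, primitive_zero, smul_zero, add_zero]

theorem odeFrame_one (t : ℝ) (L : PathSpace E →L[ℝ] PathSpace E) (e : E) :
    odeFrame t L e 1 = e + t • odeQuot t L e := rfl

theorem odeSol_eq_odeFrame {t : ℝ} {L : PathSpace E →L[ℝ] PathSpace E}
    (h : IsUnit (volterra t L)) (e : E) (s : I) : odeSol t L e s = odeFrame t L e s := by
  have h_inv : volterra t L (odeSol t L e) = BoundedContinuousFunction.const I e :=
    congrArg (fun S : PathSpace E →L[ℝ] PathSpace E => S (BoundedContinuousFunction.const I e))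
      (Ring.mul_inverse_cancel _ h)
  exact sub_eq_iff_eq_add.1 (congrArg (fun y : PathSpace E => y s) h_inv)

theorem hasDerivAt_odeFrame (t : ℝ) (L : PathSpace E →L[ℝ] PathSpace E) (e : E) (s : I) :
    HasDerivAt (odeFrame t L e) (t • L (odeSol t L e) s) s := by
  have h_deriv := ((hasDerivAt_primitive (L (odeSol t L e)) s).const_smul t).const_add e
  rwa [IccExtend_val] at h_deriv

theorem volterra_zero (L : PathSpace E →L[ℝ] PathSpace E) : volterra 0 L = 1 := by
  simp [volterra]

theorem odeQuot_zero (L : PathSpace E →L[ℝ] PathSpace E) (e : E) :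
    odeQuot 0 L e = primitive (L (BoundedContinuousFunction.const I e)) 1 := by
  rw [odeQuot, odeSol, volterra_zero, Ring.inverse_one]
  rfl

theorem contDiff_volterra :
    ContDiff ℝ ω fun q : ℝ × (PathSpace E →L[ℝ] PathSpace E) => volterra q.1 q.2 :=
  contDiff_const.sub (contDiff_fst.smul (contDiff_const.clm_comp contDiff_snd))

theorem isOpen_isUnit_volterra :
    IsOpen {q : ℝ × (PathSpace E →L[ℝ] PathSpace E) | IsUnit (volterra q.1 q.2)} :=
  (Units.isOpen (R := PathSpace E →L[ℝ] PathSpace E)).preimage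
    (contDiff_volterra (E := E)).continuous

theorem contDiffAt_odeQuot {t : ℝ} {L : PathSpace E →L[ℝ] PathSpace E}
    (h : IsUnit (volterra t L)) (e : E) :
    ContDiffAt ℝ ω (fun q : ℝ × (PathSpace E →L[ℝ] PathSpace E) => odeQuot q.1 q.2 e) (t, L) := by
  obtain ⟨u, hu⟩ := h
  have h_inverse := contDiffAt_ringInverse ℝ (n := ω) u
  rw [hu] at h_inverse
  have h_sol : ContDiffAt ℝ ω
      (fun q : ℝ × (PathSpace E →L[ℝ] PathSpace E) => odeSol q.1 q.2 e) (t, L) :=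
    (h_inverse.comp (t, L) contDiff_volterra.contDiffAt).clm_apply contDiffAt_const
  have h_primitive := ((BoundedContinuousFunction.evalCLM ℝ (1 : I)).comp
    (primitiveCLM (E := E))).contDiff (n := ω)
  exact h_primitive.contDiffAt.comp (t, L) (contDiffAt_snd.clm_apply h_sol)

end LinearODE

/-! ## The frame equation over a commutative Banach algebra -/

section FrameEquation

/-- The real coefficient functions `α, β, γ` along a segment of the matrix
`X = ((α a, β b + γ c), (β b - γ c, -α a))`. -/
structure SegmentCoeffs where
  /-- The coefficient of `a`. -/
  α : PathSpace ℝ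
  /-- The coefficient of `b`. -/
  β : PathSpace ℝ
  /-- The coefficient of `c`. -/
  γ : PathSpace ℝ

variable {A : Type*} [NormedCommRing A] [NormedAlgebra ℝ A]

/-- The map `e ↦ a (T e)` on row vectors, as a linear function of `a`. -/
def mulComp (T : A × A →L[ℝ] A × A) : A →L[ℝ] A × A →L[ℝ] A × A :=
  ((ContinuousLinearMap.compL ℝ (A × A) (A × A) (A × A)).flip T) ∘L
    ContinuousLinearMap.lsmul ℝ A

/-- The operator `y ↦ y X` on paths of row vectors, for the matrix
`X = ((α a, β b + γ c), (β b - γ c, -α a))`, as a linear function of `(a, b, c)`. -/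
def frameOperator (κ : SegmentCoeffs) :
    A × A × A →L[ℝ] PathSpace (A × A) →L[ℝ] PathSpace (A × A) :=
  let π₁ := ContinuousLinearMap.fst ℝ A A
  let π₂ := ContinuousLinearMap.snd ℝ A A
  (pointwise κ.α (mulComp (π₁.prod (-π₂)))).coprod
    ((pointwise κ.β (mulComp (π₂.prod π₁))).coprod (pointwise κ.γ (mulComp ((-π₂).prod π₁))))

theorem frameOperator_apply (κ : SegmentCoeffs) (a b c : A) (y : PathSpace (A × A)) (s : I) :
    frameOperator κ (a, b, c) y s =
      ((y s).1 * (κ.α s • a) + (y s).2 * (κ.β s • b - κ.γ s • c),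
        (y s).1 * (κ.β s • b + κ.γ s • c) - (y s).2 * (κ.α s • a)) := by
  have h_entries : frameOperator κ (a, b, c) y s =
      (κ.α s • (a * (y s).1) + (κ.β s • (b * (y s).2) + κ.γ s • (c * -(y s).2)),
        κ.α s • (a * -(y s).2) + (κ.β s • (b * (y s).1) + κ.γ s • (c * (y s).1))) := rfl
  rw [h_entries]
  simp only [Algebra.smul_def]
  ext <;> ring

variable [CompleteSpace A]

/-- Condition for the unique solvability of `P' = t P X`, `P(0) = 1`, where `X` is the matrix of
`frameOperator` for the coefficients `w = (a, b, c)`. -/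
def FrameSolvable (κ : SegmentCoeffs) (t : ℝ) (w : A × A × A) : Prop :=
  IsUnit (volterra (E := A × A) t (frameOperator κ w))

/-- The solution at `s` of `y' = t y X`, `y(0) = e` on row vectors. -/
def frameRow (κ : SegmentCoeffs) (t : ℝ) (w : A × A × A) (e : A × A) (s : ℝ) : A × A :=
  odeFrame (E := A × A) t (frameOperator κ w) e s

/-- The quotient `(y(1) - e) / t` for the solution of `y' = t y X`, `y(0) = e`. -/
def frameRowQuot (κ : SegmentCoeffs) (t : ℝ) (w : A × A × A) (e : A × A) : A × A :=
  odeQuot (E := A × A) t (frameOperator κ w) e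

theorem frameSolvable_zero (κ : SegmentCoeffs) (w : A × A × A) : FrameSolvable κ 0 w := by
  rw [FrameSolvable, volterra_zero]
  exact isUnit_one

theorem isOpen_frameSolvable (κ : SegmentCoeffs) :
    IsOpen {q : ℝ × A × A × A | FrameSolvable κ q.1 q.2} :=
  (isOpen_isUnit_volterra (E := A × A)).preimage (by fun_prop :
    Continuous fun q : ℝ × A × A × A => (q.1, frameOperator κ q.2))

theorem frameRow_zero (κ : SegmentCoeffs) (t : ℝ) (w : A × A × A) (e : A × A) :
    frameRow κ t w e 0 = e :=
  odeFrame_zero (E := A × A) t _ e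

theorem frameRow_one (κ : SegmentCoeffs) (t : ℝ) (w : A × A × A) (e : A × A) :
    frameRow κ t w e 1 = e + t • frameRowQuot κ t w e :=
  odeFrame_one (E := A × A) t _ e

theorem hasDerivAt_frameRow {κ : SegmentCoeffs} {t : ℝ} {a b c : A}
    (h : FrameSolvable κ t (a, b, c)) (e : A × A) (s : I) :
    let y := frameRow κ t (a, b, c) e
    HasDerivAt y (t • ((y s).1 * (κ.α s • a) + (y s).2 * (κ.β s • b - κ.γ s • c),
      (y s).1 * (κ.β s • b + κ.γ s • c) - (y s).2 * (κ.α s • a))) s := by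
  have h_deriv := hasDerivAt_odeFrame (E := A × A) t (frameOperator κ (a, b, c)) e s
  rwa [frameOperator_apply, odeSol_eq_odeFrame (E := A × A) h] at h_deriv

theorem frameRowQuot_zero (κ : SegmentCoeffs) (a b c u v : A) :
    frameRowQuot κ 0 (a, b, c) (u, v) =
      primitive κ.α 1 • (u * a, -(v * a)) + primitive κ.β 1 • (v * b, u * b) +
        primitive κ.γ 1 • (-(v * c), u * c) := by
  have h_const : frameOperator κ (a, b, c) (BoundedContinuousFunction.const I (u, v)) =
      tensor κ.α (u * a, -(v * a)) + tensor κ.β (v * b, u * b) + tensor κ.γ (-(v * c), u * c) := by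
    refine BoundedContinuousFunction.ext fun s => ?_
    rw [frameOperator_apply, BoundedContinuousFunction.add_apply,
      BoundedContinuousFunction.add_apply, tensor_apply, tensor_apply, tensor_apply,
      BoundedContinuousFunction.const_apply, Prod.smul_mk, Prod.smul_mk, Prod.smul_mk,
      Prod.mk_add_mk, Prod.mk_add_mk]
    simp only [Algebra.smul_def]
    congr 1 <;> ring
  rw [frameRowQuot, odeQuot_zero, h_const, primitive_add, primitive_add, primitive_tensor,
    primitive_tensor, primitive_tensor]

theorem contDiffAt_frameRowQuot {κ : SegmentCoeffs} {t : ℝ} {w : A × A × A}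
    (h : FrameSolvable κ t w) (e : A × A) :
    ContDiffAt ℝ ω (fun q : ℝ × A × A × A => frameRowQuot κ q.1 q.2 e) (t, w) := by
  have h_param : ContDiff ℝ ω fun q : ℝ × A × A × A => (q.1, frameOperator κ q.2) := by fun_prop
  exact (contDiffAt_odeQuot (E := A × A) h e).comp (t, w) h_param.contDiffAt

/-- The quotient `(P₁₁ P₂₁ - P₁₂ P₂₂) / t` for the endpoint `P` of the solution of
`P' = t P X`, `P(0) = 1`, expressed by `(P - 1) / t` so that it makes sense at `t = 0`. -/
def hatLoop (κ : SegmentCoeffs) (t : ℝ) (w : A × A × A) : A :=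
  let Z₁ := frameRowQuot κ t w (1, 0)
  let Z₂ := frameRowQuot κ t w (0, 1)
  Z₂.1 - Z₁.2 + t • (Z₁.1 * Z₂.1 - Z₁.2 * Z₂.2)

theorem smul_hatLoop (κ : SegmentCoeffs) (t : ℝ) (w : A × A × A) :
    let P₁ := frameRow κ t w (1, 0) 1
    let P₂ := frameRow κ t w (0, 1) 1
    t • hatLoop κ t w = P₁.1 * P₂.1 - P₁.2 * P₂.2 := by
  simp only [hatLoop, frameRow_one, Prod.fst_add, Prod.snd_add, Prod.smul_fst, Prod.smul_snd]
  simp only [Algebra.smul_def]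
  ring

theorem hatLoop_zero (κ : SegmentCoeffs) (a b c : A) :
    hatLoop κ 0 (a, b, c) = (-2 * primitive κ.γ 1) • c := by
  simp only [hatLoop, frameRowQuot_zero, Prod.fst_add, Prod.snd_add, Prod.smul_fst,
    Prod.smul_snd, zero_smul, one_mul, zero_mul, neg_zero, smul_zero, add_zero, zero_add, smul_neg]
  module

theorem contDiffAt_hatLoop {κ : SegmentCoeffs} {t : ℝ} {w : A × A × A} (h : FrameSolvable κ t w) :
    ContDiffAt ℝ ω (fun q : ℝ × A × A × A => hatLoop κ q.1 q.2) (t, w) := by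
  have h₁ := contDiffAt_frameRowQuot h (1, 0)
  have h₂ := contDiffAt_frameRowQuot h (0, 1)
  exact (h₂.fst.sub h₁.snd).add
    (contDiffAt_fst.smul ((h₁.fst.mul h₂.fst).sub (h₁.snd.mul h₂.snd)))

end FrameEquation

end ODE

/-! ## The potential in closed form and its symmetries -/

section Potential

variable {ρ : ℝ}

/-- The polynomial `∏ (z - p_k)`. -/
def punctPoly (φ : ℝ) (z : ℂ) : ℂ := (z ^ 2 + 1) ^ 2 - 4 * z ^ 2 * (Real.cos φ : ℂ) ^ 2

/-- The coefficient of `a` in the potential. -/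
def coefA (φ : ℝ) (z : ℂ) : ℂ :=
  -8 * z * (Real.sin φ : ℂ) * (Real.cos φ : ℂ) / punctPoly φ z

/-- The coefficient of `b` in the potential. -/
def coefB (φ : ℝ) (z : ℂ) : ℂ := 4 * (Real.cos φ : ℂ) * (z ^ 2 - 1) / punctPoly φ z

/-- The coefficient of `c` in the potential. -/
def coefC (φ : ℝ) (z : ℂ) : ℂ := -4 * (Real.sin φ : ℂ) * (z ^ 2 + 1) / punctPoly φ z

/-- The matrix `((α a, β b + γ c), (β b - γ c, -α a))`, the common shape of all values of the
potential. -/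
def formMat (α β γ a b c : ℂ) : M2 := !![α * a, β * b + γ * c; β * b - γ * c, -(α * a)]

theorem cos_eq_exp_add_inv (φ : ℝ) :
    (Real.cos φ : ℂ) = (exp (I * φ) + (exp (I * φ))⁻¹) / 2 := by
  rw [← exp_neg, ofReal_cos, Complex.cos]
  ring_nf

theorem sin_eq_exp_sub_inv (φ : ℝ) :
    (Real.sin φ : ℂ) = -I * (exp (I * φ) - (exp (I * φ))⁻¹) / 2 := by
  rw [← exp_neg, ofReal_sin, Complex.sin]
  ring_nf

theorem punctPoly_eq_prod (φ : ℝ) (z : ℂ) : punctPoly φ z =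
    (z - exp (I * φ)) * (z + (exp (I * φ))⁻¹) * (z + exp (I * φ)) * (z - (exp (I * φ))⁻¹) := by
  have h_exp := exp_ne_zero (I * φ)
  rw [punctPoly, cos_eq_exp_add_inv]
  field_simp
  ring

theorem mem_range_punct_iff {φ : ℝ} {z : ℂ} : z ∈ range (punct φ) ↔ punctPoly φ z = 0 := by
  rw [punctPoly_eq_prod]
  simp only [mem_range, Fin.exists_fin_succ, punct, exp_neg]
  simp [sub_eq_zero, add_eq_zero_iff_eq_neg, or_assoc, eq_comm]

theorem potential_eq (φ t : ℝ) (x : Param ρ) (lam : ℂ) {z : ℂ} (hz : z ∉ range (punct φ)) :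
    potential φ t x lam z = ((x.r * t : ℝ) : ℂ) •
      formMat (coefA φ z) (coefB φ z) (coefC φ z) (x.a lam) (x.b φ lam) (x.c φ lam) := by
  rw [mem_range_punct_iff, punctPoly_eq_prod] at hz
  simp only [mul_eq_zero, not_or] at hz
  obtain ⟨⟨⟨hz₁, hz₂⟩, hz₃⟩, hz₄⟩ := hz
  have h_exp := mul_inv_cancel₀ (exp_ne_zero (I * φ))
  have h_coefA : I * (1 / (z - exp (I * φ)) - 1 / (z + (exp (I * φ))⁻¹) + 1 / (z + exp (I * φ))
      - 1 / (z - (exp (I * φ))⁻¹)) = coefA φ z := by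
    rw [coefA, punctPoly_eq_prod, cos_eq_exp_add_inv, sin_eq_exp_sub_inv]
    generalize (exp (I * φ))⁻¹ = e' at *
    generalize exp (I * φ) = e at *
    field_simp
    ring
  have h_coefB : 1 / (z - exp (I * φ)) - 1 / (z + (exp (I * φ))⁻¹) - 1 / (z + exp (I * φ))
      + 1 / (z - (exp (I * φ))⁻¹) = coefB φ z := by
    rw [coefB, punctPoly_eq_prod, cos_eq_exp_add_inv]
    generalize (exp (I * φ))⁻¹ = e' at *
    generalize exp (I * φ) = e at *
    field_simp
    linear_combination (-4 * (e + e')) * h_exp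
  have h_coefC : I * (1 / (z - exp (I * φ)) + 1 / (z + (exp (I * φ))⁻¹) - 1 / (z + exp (I * φ))
      - 1 / (z - (exp (I * φ))⁻¹)) = coefC φ z := by
    rw [coefC, punctPoly_eq_prod, sin_eq_exp_sub_inv]
    generalize (exp (I * φ))⁻¹ = e' at *
    generalize exp (I * φ) = e at *
    field_simp
    linear_combination (4 * (e - e')) * h_exp
  rw [potential, Fin.sum_univ_four, ← h_coefA, ← h_coefB, ← h_coefC]
  congr 1
  ext i j
  fin_cases i <;> fin_cases j <;> simp [residue, punct, formMat, exp_neg] <;> ring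

theorem matD_inv : matD⁻¹ = !![-I, 0; 0, I] :=
  Matrix.inv_eq_right_inv (by ext i j; fin_cases i <;> fin_cases j <;> simp [matD])

theorem matC_inv : matC⁻¹ = !![0, -I; -I, 0] :=
  Matrix.inv_eq_right_inv (by ext i j; fin_cases i <;> fin_cases j <;> simp [matC])

theorem matD_inv_mul_formMat_mul_matD (α β γ a b c : ℂ) :
    matD⁻¹ * formMat α β γ a b c * matD = formMat α (-β) (-γ) a b c := by
  rw [matD_inv, matD, formMat, formMat, Matrix.mul_fin_two, Matrix.mul_fin_two]
  ext i j
  fin_cases i <;> fin_cases j <;> simp only [Fin.zero_eta, Fin.mk_one, Matrix.of_apply,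
    Matrix.cons_val_zero, Matrix.cons_val_one]
  exacts [by linear_combination (-(α * a)) * I_sq, by linear_combination (β * b + γ * c) * I_sq,
    by linear_combination (β * b - γ * c) * I_sq, by linear_combination (α * a) * I_sq]

theorem matC_inv_mul_formMat_mul_matC (α β γ a b c : ℂ) :
    matC⁻¹ * formMat α β γ a b c * matC = formMat (-α) β (-γ) a b c := by
  rw [matC_inv, matC, formMat, formMat, Matrix.mul_fin_two, Matrix.mul_fin_two]
  ext i j
  fin_cases i <;> fin_cases j <;> simp only [Fin.zero_eta, Fin.mk_one, Matrix.of_apply,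
    Matrix.cons_val_zero, Matrix.cons_val_one]
  exacts [by linear_combination (α * a) * I_sq, by linear_combination (γ * c - β * b) * I_sq,
    by linear_combination (-(β * b + γ * c)) * I_sq, by linear_combination (-(α * a)) * I_sq]

theorem smul_formMat (k α β γ a b c : ℂ) :
    k • formMat α β γ a b c = formMat (k * α) (k * β) (k * γ) a b c := by
  ext i j
  fin_cases i <;> fin_cases j <;> simp [formMat] <;> ring

theorem smul_formMat_right (k α β γ a b c : ℂ) :
    k • formMat α β γ a b c = formMat α β γ (k * a) (k * b) (k * c) := by
  ext i j
  fin_cases i <;> fin_cases j <;> simp [formMat] <;> ring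

theorem punctPoly_neg (φ : ℝ) (z : ℂ) : punctPoly φ (-z) = punctPoly φ z := by
  simp [punctPoly]

theorem punctPoly_inv (φ : ℝ) {z : ℂ} (hz : z ≠ 0) :
    punctPoly φ z⁻¹ = punctPoly φ z / z ^ 4 := by
  rw [punctPoly, punctPoly]
  field_simp
  ring

theorem punctPoly_conj (φ : ℝ) (z : ℂ) : punctPoly φ (conj z) = conj (punctPoly φ z) := by
  simp only [punctPoly, map_sub, map_mul, map_pow, map_add, map_one, conj_ofReal, map_ofNat]

theorem coefA_conj (φ : ℝ) (z : ℂ) : coefA φ (conj z) = conj (coefA φ z) := by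
  simp only [coefA, punctPoly_conj, map_div₀, map_mul, map_neg, conj_ofReal, map_ofNat]

theorem coefB_conj (φ : ℝ) (z : ℂ) : coefB φ (conj z) = conj (coefB φ z) := by
  simp only [coefB, punctPoly_conj, map_div₀, map_mul, map_sub, map_pow, map_one, conj_ofReal,
    map_ofNat]

theorem coefC_conj (φ : ℝ) (z : ℂ) : coefC φ (conj z) = conj (coefC φ z) := by
  simp only [coefC, punctPoly_conj, map_div₀, map_mul, map_add, map_neg, map_pow, map_one,
    conj_ofReal, map_ofNat]

theorem loopEval_conj (h : WRNonneg ρ) (lam : ℂ) :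
    loopEval h (conj lam) = conj (loopEval h lam) := by
  rw [loopEval, loopEval, conj_tsum]
  refine tsum_congr fun k => ?_
  rw [map_mul, map_zpow₀, h.2.2 k]

theorem Param.a_conj (x : Param ρ) (lam : ℂ) : x.a (conj lam) = conj (x.a lam) := by
  simp only [Param.a, loopEval_conj, map_add, map_sub, map_mul, map_div₀, map_inv₀, map_one,
    map_ofNat]

theorem Param.b_conj (φ : ℝ) (x : Param ρ) (lam : ℂ) : x.b φ (conj lam) = conj (x.b φ lam) := by
  simp only [Param.b, loopEval_conj, map_add, map_mul, map_neg, map_div₀, map_inv₀, map_one,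
    map_ofNat, conj_ofReal]

theorem Param.c_conj (φ : ℝ) (x : Param ρ) (lam : ℂ) : x.c φ (conj lam) = conj (x.c φ lam) := by
  simp only [Param.c, loopEval_conj, map_add, map_mul, map_neg, map_div₀, map_inv₀, map_one,
    map_ofNat, conj_ofReal]

theorem map_conj_formMat (α β γ a b c : ℂ) :
    (formMat α β γ a b c).map conj =
      formMat (conj α) (conj β) (conj γ) (conj a) (conj b) (conj c) := by
  ext i j
  fin_cases i <;> fin_cases j <;> simp [formMat]

theorem isSymmetric_potential (φ t : ℝ) (x : Param ρ) : IsSymmetric φ (potential φ t x) where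
  delta lam _ z hz := by
    have hz' : -z ∉ range (punct φ) := by
      rwa [mem_range_punct_iff, punctPoly_neg, ← mem_range_punct_iff]
    rw [potential_eq φ t x lam hz, potential_eq φ t x lam hz', Matrix.mul_smul, Matrix.smul_mul,
      matD_inv_mul_formMat_mul_matD, smul_comm, smul_formMat]
    simp [coefA, coefB, coefC, punctPoly_neg, neg_div]
  tau lam _ z hz hz₀ := by
    have h_poly := mem_range_punct_iff.not.1 hz
    have hz' : z⁻¹ ∉ range (punct φ) := by
      rw [mem_range_punct_iff, punctPoly_inv φ hz₀]
      positivity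
    rw [one_div, potential_eq φ t x lam hz, potential_eq φ t x lam hz', Matrix.mul_smul,
      Matrix.smul_mul, matC_inv_mul_formMat_mul_matC, smul_comm, smul_formMat]
    simp only [coefA, coefB, coefC, punctPoly_inv φ hz₀]
    congr 2 <;> field_simp <;> ring
  sigma lam _ z hz := by
    have hz' : conj z ∉ range (punct φ) := by
      rw [mem_range_punct_iff, punctPoly_conj, map_eq_zero]
      exact mem_range_punct_iff.not.1 hz
    rw [potential_eq φ t x lam hz, potential_eq φ t x (conj lam) hz',
      Matrix.map_smul' _ _ _ (map_mul _), map_conj_formMat]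
    simp only [coefA_conj, coefB_conj, coefC_conj, Param.a_conj, Param.b_conj, Param.c_conj,
      conj_conj, conj_ofReal]

end Potential

/-! ## The DPW property -/

section DPWProperty

theorem isNilpotent_vecMulVec {n R : Type*} [Fintype n] [DecidableEq n] [CommRing R] {u v : n → R}
    (h : v ⬝ᵥ u = 0) : IsNilpotent (Matrix.vecMulVec u v) :=
  ⟨2, by rw [pow_two, Matrix.vecMulVec_mul_vecMulVec, h, zero_smul, Matrix.vecMulVec_zero]⟩

theorem analyticAt_mul_mul_apply {X Y : M2} {B : ℂ → ℂ → M2} {p : ℂ × ℂ}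
    (h : ∀ i j, AnalyticAt ℂ (fun q : ℂ × ℂ => B q.1 q.2 i j) p) (i j : Fin 2) :
    AnalyticAt ℂ (fun q : ℂ × ℂ => (X * B q.1 q.2 * Y) i j) p := by
  simp only [Matrix.mul_apply, Fin.sum_univ_two]
  fun_prop

theorem IsDPWChart.conj {U : Set ℂ} {E : ℂ → ℂ → M2} (h : IsDPWChart U E) (u : M2ˣ) :
    IsDPWChart U fun lam z => (↑u⁻¹ : M2) * E lam z * u := by
  obtain ⟨B, h_analytic, h_eq, h_trace, h_zero⟩ := h
  refine ⟨fun lam z => (↑u⁻¹ : M2) * B lam z * u,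
    fun i j q hq => analyticAt_mul_mul_apply (fun i j => h_analytic i j q hq) i j,
    fun lam hlam z hz => ?_, fun lam hlam z hz => ?_, fun z hz => ⟨fun h => ?_, ?_⟩⟩
  · beta_reduce
    rw [h_eq lam hlam z hz, Matrix.mul_smul, Matrix.smul_mul]
  · rw [Matrix.trace_mul_cycle, u.mul_inv, one_mul, h_trace lam hlam z hz]
  · refine (h_zero z hz).1 ?_
    simpa [mul_assoc] using congrArg (fun M : M2 => u * M * (↑u⁻¹ : M2)) h
  · obtain ⟨n, hn⟩ := (h_zero z hz).2
    exact ⟨n, by rw [Units.conj_pow', hn, mul_zero, zero_mul]⟩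

variable {ρ : ℝ}

theorem differentiableOn_loopEval [Fact (1 < ρ)] (h : WRNonneg ρ) :
    DifferentiableOn ℂ (loopEval h) (Metric.ball 0 ρ) := by
  refine differentiableOn_tsum_of_summable_norm h.1.2 (fun k z _ => ?_) Metric.isOpen_ball
    fun k z hz => ?_
  · rcases lt_or_ge k 0 with hk | hk
    · simpa only [h.2.1 k hk, zero_mul] using differentiableWithinAt_const (0 : ℂ)
    · exact ((differentiableAt_zpow.2 (Or.inr hk)).const_mul _).differentiableWithinAt
  · rcases lt_or_ge k 0 with hk | hk
    · simp [h.2.1 k hk]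
    · obtain ⟨n, rfl⟩ := Int.eq_ofNat_of_zero_le hk
      rw [norm_mul, norm_zpow, zpow_natCast, Int.natAbs_natCast]
      refine mul_le_mul_of_nonneg_left (pow_le_pow_left₀ (norm_nonneg z) ?_ n) (norm_nonneg _)
      exact (mem_ball_zero_iff.1 hz).le.trans (le_abs_self ρ)

theorem analyticAt_loopEval [hρ : Fact (1 < ρ)] (h : WRNonneg ρ) {z : ℂ}
    (hz : z ∈ Metric.closedBall (0 : ℂ) 1) : AnalyticAt ℂ (loopEval h) z :=
  (differentiableOn_loopEval h).analyticAt
    (Metric.isOpen_ball.mem_nhds (Metric.closedBall_subset_ball hρ.out hz))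

/-- `λ a(λ)`, as a function on the closed disc. -/
def discA (x : Param ρ) (lam : ℂ) : ℂ := 1 / 2 * (1 - lam ^ 2) + lam * loopEval x.1 lam

/-- `λ b(λ)`, as a function on the closed disc. -/
def discB (φ : ℝ) (x : Param ρ) (lam : ℂ) : ℂ :=
  -(1 / 2) * (Real.sin φ : ℂ) * (1 + lam ^ 2) + lam * loopEval x.2.1 lam

/-- `λ c(λ)`, as a function on the closed disc. -/
def discC (φ : ℝ) (x : Param ρ) (lam : ℂ) : ℂ :=
  -(1 / 2) * (Real.cos φ : ℂ) * (1 + lam ^ 2) + lam * loopEval x.2.2.1 lam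

theorem discA_eq_mul (x : Param ρ) {lam : ℂ} (h : lam ≠ 0) : discA x lam = lam * x.a lam := by
  rw [discA, Param.a]
  field_simp

theorem discB_eq_mul (φ : ℝ) (x : Param ρ) {lam : ℂ} (h : lam ≠ 0) :
    discB φ x lam = lam * x.b φ lam := by
  rw [discB, Param.b]
  field_simp

theorem discC_eq_mul (φ : ℝ) (x : Param ρ) {lam : ℂ} (h : lam ≠ 0) :
    discC φ x lam = lam * x.c φ lam := by
  rw [discC, Param.c]
  field_simp

/-- The holomorphic extension of `λ ↦ λ E(λ, z)` to the closed disc, where `E` is the potential. -/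
def discPotential (φ t : ℝ) (x : Param ρ) (lam z : ℂ) : M2 :=
  ((x.r * t : ℝ) : ℂ) •
    formMat (coefA φ z) (coefB φ z) (coefC φ z) (discA x lam) (discB φ x lam) (discC φ x lam)

theorem analyticAt_discPotential [Fact (1 < ρ)] (φ t : ℝ) (x : Param ρ) {lam z : ℂ}
    (hlam : lam ∈ Metric.closedBall (0 : ℂ) 1) (hz : punctPoly φ z ≠ 0) (i j : Fin 2) :
    AnalyticAt ℂ (fun q : ℂ × ℂ => discPotential φ t x q.1 q.2 i j) (lam, z) := by
  have h_poly : AnalyticAt ℂ (punctPoly φ) z := by unfold punctPoly; fun_prop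
  have h_a : AnalyticAt ℂ (discA x) lam := by
    have := analyticAt_loopEval x.1 hlam
    unfold discA
    fun_prop
  have h_b : AnalyticAt ℂ (discB φ x) lam := by
    have := analyticAt_loopEval x.2.1 hlam
    unfold discB
    fun_prop
  have h_c : AnalyticAt ℂ (discC φ x) lam := by
    have := analyticAt_loopEval x.2.2.1 hlam
    unfold discC
    fun_prop
  have h_lam {f : ℂ → ℂ} (hf : AnalyticAt ℂ f lam) :
      AnalyticAt ℂ (fun q : ℂ × ℂ => f q.1) (lam, z) := hf.fun_comp (g := f) analyticAt_fst
  have h_z {f : ℂ → ℂ} (hf : AnalyticAt ℂ f z) :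
      AnalyticAt ℂ (fun q : ℂ × ℂ => f q.2) (lam, z) := hf.fun_comp (g := f) analyticAt_snd
  have h_αa := (h_z (f := coefA φ) (.div (by fun_prop) h_poly hz)).mul (h_lam h_a)
  have h_βb := (h_z (f := coefB φ) (.div (by fun_prop) h_poly hz)).mul (h_lam h_b)
  have h_γc := (h_z (f := coefC φ) (.div (by fun_prop) h_poly hz)).mul (h_lam h_c)
  have h_rt : AnalyticAt ℂ (fun _ : ℂ × ℂ => ((x.r * t : ℝ) : ℂ)) (lam, z) := analyticAt_const
  fin_cases i <;> fin_cases j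
  exacts [h_rt.mul h_αa, h_rt.mul (h_βb.add h_γc), h_rt.mul (h_βb.sub h_γc), h_rt.mul h_αa.neg]

theorem discPotential_zero (φ t : ℝ) (x : Param ρ) (z : ℂ) :
    discPotential φ t x 0 z =
      ((x.r * t : ℝ) * (4 * Real.sin φ * Real.cos φ / punctPoly φ z) : ℂ) •
        Matrix.vecMulVec ![1, z] ![-z, 1] := by
  rw [discPotential, mul_smul]
  congr 1
  ext i j
  fin_cases i <;> fin_cases j <;>
    simp [formMat, coefA, coefB, coefC, discA, discB, discC, -ofReal_sin, -ofReal_cos] <;> ring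

theorem isDPWChart_potential [Fact (1 < ρ)] {φ t : ℝ} (h_sin : Real.sin φ ≠ 0)
    (h_cos : Real.cos φ ≠ 0) {x : Param ρ} (hx : x.r * t ≠ 0) :
    IsDPWChart (range (punct φ))ᶜ (potential φ t x) := by
  refine ⟨discPotential φ t x, ?_, ?_, ?_, fun z hz => ⟨fun h => ?_, ?_⟩⟩
  · rintro i j ⟨lam, z⟩ ⟨hlam, hz⟩
    exact analyticAt_discPotential φ t x hlam (mem_range_punct_iff.not.1 hz) i j
  · intro lam hlam z hz
    have hlam₀ : lam ≠ 0 := Metric.ne_of_mem_sphere hlam one_ne_zero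
    rw [discPotential, potential_eq φ t x lam hz, discA_eq_mul x hlam₀, discB_eq_mul φ x hlam₀,
      discC_eq_mul φ x hlam₀, ← smul_formMat_right, smul_comm]
  · intro lam _ z _
    simp [discPotential, Matrix.trace_fin_two, formMat]
  · have h_entry : discPotential φ t x 0 z 0 1 = 0 := congrFun₂ h 0 1
    have h_poly := mem_range_punct_iff.not.1 hz
    have h_trig : (4 * Real.sin φ * Real.cos φ : ℂ) ≠ 0 := by
      exact_mod_cast mul_ne_zero (mul_ne_zero four_ne_zero h_sin) h_cos
    have h_factor := mul_ne_zero (ofReal_ne_zero.2 hx) (div_ne_zero h_trig h_poly)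
    refine h_factor ?_
    simpa only [discPotential_zero, Matrix.smul_apply, Matrix.vecMulVec_apply,
      Matrix.cons_val_zero, Matrix.cons_val_one, one_mul, smul_eq_mul, mul_one] using h_entry
  · rw [discPotential_zero]
    exact (isNilpotent_vecMulVec (by simp)).smul _

theorem setOf_inv_notMem_range_punct (φ : ℝ) :
    {w : ℂ | w = 0 ∨ w⁻¹ ∉ range (punct φ)} = (range (punct φ))ᶜ := by
  ext w
  simp only [mem_ofPred_eq, mem_compl_iff, mem_range_punct_iff]
  rcases eq_or_ne w 0 with rfl | hw
  · simp [punctPoly]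
  · simp [punctPoly_inv φ hw, hw]

theorem isDPWPotential_potential [Fact (1 < ρ)] {φ t : ℝ} (h_sin : Real.sin φ ≠ 0)
    (h_cos : Real.cos φ ≠ 0) {x : Param ρ} (hx : x.r * t ≠ 0) :
    IsDPWPotential φ (potential φ t x) := by
  have h_chart := isDPWChart_potential h_sin h_cos hx
  have h_det : IsUnit matC.det := by simp [matC, Matrix.det_fin_two_of]
  refine ⟨h_chart, fun lam w => matC⁻¹ * potential φ t x lam w * matC, ?_,
    fun lam hlam w hw hw' => ?_⟩
  · rw [setOf_inv_notMem_range_punct]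
    exact h_chart.conj (matC.nonsingInvUnit h_det)
  · have hw_mem : w ∉ range (punct φ) :=
      (setOf_inv_notMem_range_punct φ).subset (Or.inr hw')
    rw [← one_div w]
    exact ((isSymmetric_potential φ t x).tau lam hlam w hw_mem hw).symm

end DPWProperty

/-! ## Nonnegative loops inside the algebra of real loops -/

section NonnegativeLoops

open RealLoop

variable {ρ : ℝ}

theorem ofReal_re_coeff (h : WRNonneg ρ) (k : ℤ) :
    ((h.1.1.coeff k).re : ℂ) = h.1.1.coeff k :=
  conj_eq_iff_re.1 (h.2.2 k)

theorem abs_re_coeff_mul_weight (h : WRNonneg ρ) (k : ℤ) :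
    |(h.1.1.coeff k).re| * weight ρ k = ‖h.1.1.coeff k‖ * |ρ| ^ k.natAbs := by
  rw [← Real.norm_eq_abs, ← Complex.norm_real, ofReal_re_coeff, weight]

theorem summable_re_coeff (h : WRNonneg ρ) :
    Summable fun k => |(h.1.1.coeff k).re| * weight ρ k := by
  simp only [abs_re_coeff_mul_weight]
  exact h.1.2

/-- The coefficients of the nonnegative part of a real loop. -/
def nonnegCoeffs (f : RealLoop ρ) : Coeffs := fun k => if 0 ≤ k then (f.coeff k : ℂ) else 0

theorem coeff_nonnegCoeffs (f : RealLoop ρ) (k : ℤ) :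
    (nonnegCoeffs f).coeff k = ((if 0 ≤ k then f.coeff k else 0 : ℝ) : ℂ) :=
  (apply_ite ofReal _ _ _).symm

variable [hρ : Fact (1 < ρ)]

/-- The subalgebra of the real loops with only nonnegative powers of `λ`: the image of
`W_{ℝ,ρ}^{≥0}`. -/
def nonnegLoops (ρ : ℝ) [Fact (1 < ρ)] : Subalgebra ℝ (RealLoop ρ) where
  carrier := {f | ∀ k < 0, f.coeff k = 0}
  mul_mem' {f g} hf hg k hk := by
    rw [coeff_mul]
    refine (tsum_congr fun j => ?_).trans tsum_zero
    rcases lt_or_ge j 0 with hj | hj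
    · rw [hf j hj, zero_mul]
    · rw [hg (k - j) (by lia), mul_zero]
  add_mem' {f g} hf hg k hk := by rw [coeff_add, hf k hk, hg k hk, add_zero]
  algebraMap_mem' r k hk := by
    rw [Algebra.algebraMap_eq_smul_one, coeff_smul, one_eq_monomial, coeff_monomial,
      Pi.single_eq_of_ne hk.ne, mul_zero]

theorem monomial_mem_nonnegLoops {n : ℤ} (hn : 0 ≤ n) : monomial n ∈ nonnegLoops ρ := fun k hk => by
  rw [coeff_monomial, Pi.single_eq_of_ne (by lia)]

/-- The isometric inclusion of `W_{ℝ,ρ}^{≥0}` into the Banach algebra of real loops. -/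
def toRealLoop : WRNonneg ρ →ₗᵢ[ℝ] RealLoop ρ where
  toFun h := ofCoeff (fun k => (h.1.1.coeff k).re) (summable_re_coeff h)
  map_add' f g := RealLoop.ext fun k => by simp
  map_smul' r f := RealLoop.ext fun k => by simp
  norm_map' h := (norm_eq_tsum _).trans (tsum_congr fun k =>
    (congrArg (|·| * weight ρ k) (coeff_ofCoeff _ (summable_re_coeff h) k)).trans
      (abs_re_coeff_mul_weight h k))

theorem coeff_toRealLoop (h : WRNonneg ρ) (k : ℤ) :
    (toRealLoop h).coeff k = (h.1.1.coeff k).re :=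
  coeff_ofCoeff _ (summable_re_coeff h) k

theorem toRealLoop_mem (h : WRNonneg ρ) : toRealLoop h ∈ nonnegLoops ρ := fun k hk => by
  rw [coeff_toRealLoop, h.2.1 k hk, zero_re]

theorem eval_toRealLoop {z : ℂ} (hz : ‖z‖ = 1) (h : WRNonneg ρ) :
    eval z (toRealLoop h) = loopEval h z := by
  rw [← (hasSum_eval hz (toRealLoop h)).tsum_eq, loopEval]
  simp only [coeff_toRealLoop, ofReal_re_coeff]

theorem norm_coeff_nonnegCoeffs_le (f : RealLoop ρ) (k : ℤ) :
    ‖(nonnegCoeffs f).coeff k‖ * |ρ| ^ k.natAbs ≤ |f.coeff k| * weight ρ k := by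
  refine mul_le_mul_of_nonneg_right ?_ (weight_pos ρ k).le
  rw [coeff_nonnegCoeffs]
  split_ifs <;> simp

theorem summable_nonnegCoeffs (f : RealLoop ρ) :
    Summable fun k : ℤ => ‖(nonnegCoeffs f).coeff k‖ * |ρ| ^ k.natAbs :=
  .of_nonneg_of_le (fun _ => by positivity) (norm_coeff_nonnegCoeffs_le f) f.summable_coeff

/-- The projection `∑ h_k λ^k ↦ ∑_{k ≥ 0} h_k λ^k` onto the nonnegative loops. -/
def nonnegPart : RealLoop ρ →L[ℝ] WRNonneg ρ :=
  LinearMap.mkContinuous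
    { toFun := fun f => ⟨⟨nonnegCoeffs f, summable_nonnegCoeffs f⟩,
        fun k hk => if_neg hk.not_ge, fun k => by rw [coeff_nonnegCoeffs, conj_ofReal]⟩
      map_add' := fun f g => Subtype.ext (Subtype.ext (funext fun k => by
        change (nonnegCoeffs (f + g)).coeff k = (nonnegCoeffs f).coeff k + (nonnegCoeffs g).coeff k
        simp only [coeff_nonnegCoeffs]
        split_ifs <;> simp))
      map_smul' := fun r f => Subtype.ext (Subtype.ext (funext fun k => by
        change (nonnegCoeffs (r • f)).coeff k = r • (nonnegCoeffs f).coeff k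
        simp only [coeff_nonnegCoeffs]
        split_ifs <;> simp)) } 1
    fun f => by
      rw [one_mul, norm_eq_tsum]
      exact Summable.tsum_le_tsum (norm_coeff_nonnegCoeffs_le f) (summable_nonnegCoeffs f)
        f.summable_coeff

theorem coeff_toRealLoop_nonnegPart (f : RealLoop ρ) (k : ℤ) :
    (toRealLoop (nonnegPart f)).coeff k = if 0 ≤ k then f.coeff k else 0 := by
  rw [coeff_toRealLoop]
  exact (congrArg re (coeff_nonnegCoeffs f k)).trans (ofReal_re _)

theorem toRealLoop_nonnegPart {f : RealLoop ρ} (hf : f ∈ nonnegLoops ρ) :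
    toRealLoop (nonnegPart f) = f :=
  RealLoop.ext fun k => by
    rw [coeff_toRealLoop_nonnegPart]
    split_ifs with hk
    · rfl
    · exact (hf k (not_le.1 hk)).symm

theorem nonnegPart_toRealLoop (h : WRNonneg ρ) : nonnegPart (toRealLoop h) = h :=
  toRealLoop.injective (toRealLoop_nonnegPart (toRealLoop_mem h))

theorem nonnegPart_eq_zero_iff {f : RealLoop ρ} :
    nonnegPart f = 0 ↔ ∀ k, 0 ≤ k → f.coeff k = 0 := by
  rw [← toRealLoop.injective.eq_iff, map_zero]
  refine ⟨fun h k hk => ?_, fun h => RealLoop.ext fun k => ?_⟩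
  · simpa only [coeff_toRealLoop_nonnegPart, if_pos hk, coeff_zero] using
      congrArg (fun g => coeff g k) h
  · rw [coeff_toRealLoop_nonnegPart, coeff_zero]
    exact ite_eq_right_iff.2 (h k)

theorem nonnegPart_eq_zero_iff_of_mem {f : RealLoop ρ} (hf : f ∈ nonnegLoops ρ) :
    nonnegPart f = 0 ↔ f = 0 := by
  rw [← toRealLoop.injective.eq_iff, map_zero, toRealLoop_nonnegPart hf]

instance : CompleteSpace (WRNonneg ρ) := by
  rw [completeSpace_iff_isComplete_range (toRealLoop (ρ := ρ)).isometry.isUniformInducing]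
  refine IsClosed.isComplete ?_
  have h_range : range (toRealLoop : WRNonneg ρ → RealLoop ρ) =
      {f | toRealLoop (nonnegPart f) = f} :=
    Subset.antisymm (range_subset_iff.2 fun h => congrArg toRealLoop (nonnegPart_toRealLoop h))
      fun f hf => ⟨nonnegPart f, hf⟩
  rw [h_range]
  exact isClosed_eq ((toRealLoop (ρ := ρ)).continuous.comp (nonnegPart (ρ := ρ)).continuous)
    continuous_id

end NonnegativeLoops

/-! ## Division by `1 - λ²` -/

section Division

open RealLoop

variable {ρ : ℝ} [hρ : Fact (1 < ρ)]

/-- The left shift by `n` places `h ↦ (λ⁻ⁿ h)_{≥ 0}`. -/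
def leftShift (n : ℕ) : WRNonneg ρ →L[ℝ] WRNonneg ρ :=
  nonnegPart ∘L ContinuousLinearMap.mul ℝ (RealLoop ρ) (monomial (-n)) ∘L
    toRealLoop.toContinuousLinearMap

theorem leftShift_apply (n : ℕ) (h : WRNonneg ρ) :
    leftShift n h = nonnegPart (monomial (-n) * toRealLoop h) := rfl

theorem coeff_toRealLoop_leftShift (n : ℕ) (h : WRNonneg ρ) (k : ℤ) :
    (toRealLoop (leftShift n h)).coeff k = if 0 ≤ k then (toRealLoop h).coeff (k + n) else 0 := by
  rw [leftShift_apply, coeff_toRealLoop_nonnegPart, coeff_monomial_mul, sub_neg_eq_add]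

theorem norm_leftShift_le (n : ℕ) : ‖(leftShift n : WRNonneg ρ →L[ℝ] WRNonneg ρ)‖ ≤ (ρ ^ n)⁻¹ := by
  have hρ_pos : 0 < ρ := one_pos.trans hρ.out
  refine ContinuousLinearMap.opNorm_le_bound _ (by positivity) fun h => ?_
  rw [← toRealLoop.norm_map (leftShift n h), ← toRealLoop.norm_map h, norm_eq_tsum, norm_eq_tsum,
    ← tsum_mul_left]
  have h_summable : Summable fun k : ℤ =>
      (ρ ^ n)⁻¹ * (|(toRealLoop h).coeff (k + n)| * weight ρ (k + n)) :=
    ((Equiv.addRight (n : ℤ)).summable_iff.2 (toRealLoop h).summable_coeff).mul_left _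
  refine (Summable.tsum_le_tsum (fun k => ?_)
    (toRealLoop (leftShift n h)).summable_coeff h_summable).trans_eq
    ((Equiv.addRight (n : ℤ)).tsum_eq
      fun k => (ρ ^ n)⁻¹ * (|(toRealLoop h).coeff k| * weight ρ k))
  rw [coeff_toRealLoop_leftShift]
  split_ifs with hk
  · obtain ⟨m, rfl⟩ := Int.eq_ofNat_of_zero_le hk
    have h_weight : weight ρ (m + n) = ρ ^ n * weight ρ m := by
      rw [weight, weight, ← Int.natCast_add, Int.natAbs_natCast, Int.natAbs_natCast, pow_add,
        abs_of_pos hρ_pos, mul_comm]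
    rw [h_weight]
    field_simp
    exact le_rfl
  · rw [abs_zero, zero_mul]
    exact mul_nonneg (by positivity) (abs_mul_weight_nonneg ρ _ _)

theorem isUnit_one_sub_leftShift {n : ℕ} (hn : n ≠ 0) :
    IsUnit (1 - leftShift n : WRNonneg ρ →L[ℝ] WRNonneg ρ) :=
  isUnit_one_sub_of_norm_lt_one (R := WRNonneg ρ →L[ℝ] WRNonneg ρ) (x := leftShift n)
    ((norm_leftShift_le n).trans_lt (inv_lt_one_of_one_lt₀ (one_lt_pow₀ hρ.out hn)))

theorem bijective_one_sub_leftShift {n : ℕ} (hn : n ≠ 0) :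
    Function.Bijective (1 - leftShift n : WRNonneg ρ →L[ℝ] WRNonneg ρ) :=
  (Module.End.isUnit_iff _).1
    ((isUnit_one_sub_leftShift hn).map ContinuousLinearMap.toLinearMapRingHom)

theorem nonnegPart_monomial_neg_mul_one_sub_mul (n : ℕ) (g : WRNonneg ρ) :
    nonnegPart (monomial (-n) * ((1 - monomial n) * toRealLoop g)) =
      -(1 - leftShift n : WRNonneg ρ →L[ℝ] WRNonneg ρ) g := by
  rw [← mul_assoc, mul_sub, mul_one, monomial_mul_monomial, neg_add_cancel, ← one_eq_monomial,
    sub_mul, one_mul, map_sub, nonnegPart_toRealLoop, ← leftShift_apply]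
  exact (neg_sub g (leftShift n g)).symm

theorem coeff_smul_one_add_smul_monomial_one (α β : ℝ) (k : ℤ) :
    (α • 1 + β • monomial 1 : RealLoop ρ).coeff k =
      α * (Pi.single 0 1 : ℤ → ℝ) k + β * (Pi.single 1 1 : ℤ → ℝ) k := by
  rw [coeff_add, coeff_smul, coeff_smul, one_eq_monomial, coeff_monomial, coeff_monomial]

theorem nonnegPart_monomial_neg_two_mul_eq_zero_iff {f : RealLoop ρ} (hf : f ∈ nonnegLoops ρ) :
    nonnegPart (monomial (-2) * f) = 0 ↔ ∃ α β : ℝ, f = α • 1 + β • monomial 1 := by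
  rw [nonnegPart_eq_zero_iff]
  simp only [coeff_monomial_mul, sub_neg_eq_add]
  constructor
  · refine fun h => ⟨f.coeff 0, f.coeff 1, RealLoop.ext fun k => ?_⟩
    rw [coeff_smul_one_add_smul_monomial_one]
    rcases lt_or_ge k 2 with hk | hk
    · rcases lt_or_ge k 0 with hk' | hk'
      · simp [hf k hk', Pi.single_eq_of_ne hk'.ne, Pi.single_eq_of_ne (hk'.trans one_pos).ne]
      · interval_cases k <;> simp
    · have := h (k - 2) (by lia)
      rw [sub_add_cancel] at this
      rw [this, Pi.single_eq_of_ne (by lia), Pi.single_eq_of_ne (by lia), mul_zero, mul_zero,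
        add_zero]
  · rintro ⟨α, β, rfl⟩ k hk
    rw [coeff_smul_one_add_smul_monomial_one, Pi.single_eq_of_ne (by lia),
      Pi.single_eq_of_ne (by lia), mul_zero, mul_zero, add_zero]

theorem exists_one_sub_sq_mul_eq (f : WRNonneg ρ) : ∃ (g : WRNonneg ρ) (α β : ℝ),
    (1 - monomial 2) * toRealLoop g = toRealLoop f + (α • 1 + β • monomial 1) := by
  obtain ⟨g, hg⟩ := (bijective_one_sub_leftShift two_ne_zero).2 (-leftShift 2 f)
  have h_mem : (1 - monomial 2) * toRealLoop g - toRealLoop f ∈ nonnegLoops ρ :=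
    sub_mem (mul_mem (sub_mem (one_mem _) (monomial_mem_nonnegLoops zero_le_two))
      (toRealLoop_mem g)) (toRealLoop_mem f)
  obtain ⟨α, β, h⟩ := (nonnegPart_monomial_neg_two_mul_eq_zero_iff h_mem).1 (by
    have h_shift := nonnegPart_monomial_neg_mul_one_sub_mul 2 g
    rw [hg, neg_neg, leftShift_apply] at h_shift
    rw [mul_sub, map_sub, sub_eq_zero]
    exact h_shift)
  exact ⟨g, α, β, by rw [← h, add_sub_cancel]⟩

theorem eq_zero_of_one_sub_sq_mul_eq {g : WRNonneg ρ} {α β : ℝ}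
    (h : (1 - monomial 2) * toRealLoop g = α • 1 + β • monomial 1) : g = 0 ∧ α = 0 ∧ β = 0 := by
  have h_mem : α • 1 + β • monomial 1 ∈ nonnegLoops ρ :=
    add_mem (Subalgebra.smul_mem _ (one_mem _) α)
      (Subalgebra.smul_mem _ (monomial_mem_nonnegLoops zero_le_one) β)
  have hg : g = 0 := by
    have h_shift := nonnegPart_monomial_neg_mul_one_sub_mul 2 g
    refine (bijective_one_sub_leftShift two_ne_zero).1 ?_
    rw [map_zero, ← neg_eq_zero, ← h_shift]
    exact (congrArg (fun f => nonnegPart (monomial (-2) * f)) h).trans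
      ((nonnegPart_monomial_neg_two_mul_eq_zero_iff h_mem).2 ⟨α, β, rfl⟩)
  have h_coeff (k : ℤ) : α * (Pi.single 0 1 : ℤ → ℝ) k + β * (Pi.single 1 1 : ℤ → ℝ) k = 0 := by
    rw [← coeff_smul_one_add_smul_monomial_one (ρ := ρ), ← h, hg, map_zero, mul_zero, coeff_zero]
  exact ⟨hg, by simpa using h_coeff 0, by simpa using h_coeff 1⟩

end Division

/-! ## The principal solutions along the two segments -/

section Segments

open scoped unitInterval

/-- The restriction of `punctPoly φ` to the real axis. -/
def segPoly (φ s : ℝ) : ℝ := (s ^ 2 - 1) ^ 2 + 4 * s ^ 2 * Real.sin φ ^ 2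

theorem segPoly_pos {φ : ℝ} (h_sin : Real.sin φ ≠ 0) (s : ℝ) : 0 < segPoly φ s := by
  rw [segPoly]
  rcases eq_or_ne s 0 with rfl | hs
  · norm_num
  · positivity

theorem continuous_segPoly (φ : ℝ) : Continuous (segPoly φ) := by
  unfold segPoly
  fun_prop

theorem segPoly_eq_mul (φ s : ℝ) : segPoly φ s =
    (Real.sin φ ^ 2 + (s - Real.cos φ) ^ 2) * (Real.sin φ ^ 2 + (s + Real.cos φ) ^ 2) := by
  rw [segPoly, Real.sin_sq]
  ring

theorem ofReal_segPoly (φ s : ℝ) : (segPoly φ s : ℂ) = punctPoly φ s := by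
  rw [segPoly, punctPoly, Real.sin_sq]
  push_cast
  ring

theorem ofReal_segPoly_pi_div_two_sub (φ s : ℝ) :
    (segPoly (Real.pi / 2 - φ) s : ℂ) = punctPoly φ (s * Complex.I) := by
  rw [segPoly, punctPoly, Real.sin_pi_div_two_sub, mul_pow, I_sq]
  push_cast
  ring

/-- The coefficients of the potential along the segment from `0` to `1`. -/
def realCoeffs (φ : ℝ) (h_sin : Real.sin φ ≠ 0) : SegmentCoeffs :=
  let quot (f : ℝ → ℝ) (hf : Continuous f) : PathSpace ℝ :=
    BoundedContinuousFunction.mkOfCompact ⟨fun s : I => f s / segPoly φ s,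
      (hf.div (continuous_segPoly φ) fun s => (segPoly_pos h_sin s).ne').comp
        continuous_subtype_val⟩
  { α := quot (fun s => -8 * s * Real.sin φ * Real.cos φ) (by fun_prop)
    β := quot (fun s => 4 * Real.cos φ * (s ^ 2 - 1)) (by fun_prop)
    γ := quot (fun s => -4 * Real.sin φ * (s ^ 2 + 1)) (by fun_prop) }

section Values

variable {φ : ℝ} (h_sin : Real.sin φ ≠ 0) (s : I)

theorem realCoeffs_α_apply :
    (realCoeffs φ h_sin).α s = -8 * s * Real.sin φ * Real.cos φ / segPoly φ s :=
  rfl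

theorem realCoeffs_β_apply :
    (realCoeffs φ h_sin).β s = 4 * Real.cos φ * ((s : ℝ) ^ 2 - 1) / segPoly φ s :=
  rfl

theorem realCoeffs_γ_apply :
    (realCoeffs φ h_sin).γ s = -4 * Real.sin φ * ((s : ℝ) ^ 2 + 1) / segPoly φ s :=
  rfl

theorem coefA_ofReal : coefA φ (s : ℝ) = (realCoeffs φ h_sin).α s := by
  rw [coefA, realCoeffs_α_apply, ← ofReal_segPoly]
  push_cast
  rfl

theorem coefB_ofReal : coefB φ (s : ℝ) = (realCoeffs φ h_sin).β s := by
  rw [coefB, realCoeffs_β_apply, ← ofReal_segPoly]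
  push_cast
  rfl

theorem coefC_ofReal : coefC φ (s : ℝ) = (realCoeffs φ h_sin).γ s := by
  rw [coefC, realCoeffs_γ_apply, ← ofReal_segPoly]
  push_cast
  rfl

end Values

/-- The coefficients along the segment from `0` to `i`, up to conjugation by `diag(1, -i)` and
exchange of `b` and `c`. -/
def imagCoeffs (φ : ℝ) (h_cos : Real.cos φ ≠ 0) : SegmentCoeffs :=
  realCoeffs (Real.pi / 2 - φ) (by rwa [Real.sin_pi_div_two_sub])

section ImaginaryValues

variable {φ : ℝ} (h_cos : Real.cos φ ≠ 0) (s : I)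

theorem coefA_ofReal_mul_I :
    coefA φ ((s : ℝ) * Complex.I) = Complex.I * (imagCoeffs φ h_cos).α s := by
  rw [coefA, imagCoeffs, realCoeffs_α_apply, ← ofReal_segPoly_pi_div_two_sub,
    Real.sin_pi_div_two_sub, Real.cos_pi_div_two_sub]
  push_cast
  ring

theorem coefB_ofReal_mul_I : coefB φ ((s : ℝ) * Complex.I) = (imagCoeffs φ h_cos).γ s := by
  rw [coefB, imagCoeffs, realCoeffs_γ_apply, ← ofReal_segPoly_pi_div_two_sub,
    Real.sin_pi_div_two_sub, mul_pow, I_sq]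
  push_cast
  ring

theorem coefC_ofReal_mul_I : coefC φ ((s : ℝ) * Complex.I) = (imagCoeffs φ h_cos).β s := by
  rw [coefC, imagCoeffs, realCoeffs_β_apply, ← ofReal_segPoly_pi_div_two_sub,
    Real.cos_pi_div_two_sub, mul_pow, I_sq]
  push_cast
  ring

end ImaginaryValues

theorem hasDerivAt_arctan_add_arctan {φ : ℝ} (h_sin : Real.sin φ ≠ 0) (s : ℝ) :
    HasDerivAt (fun s => -2 * (Real.arctan ((s - Real.cos φ) / Real.sin φ) +
        Real.arctan ((s + Real.cos φ) / Real.sin φ)))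
      (-4 * Real.sin φ * (s ^ 2 + 1) / segPoly φ s) s := by
  have h_sub := (((hasDerivAt_id s).sub_const (Real.cos φ)).div_const (Real.sin φ)).arctan
  have h_add := (((hasDerivAt_id s).add_const (Real.cos φ)).div_const (Real.sin φ)).arctan
  refine ((h_sub.add h_add).const_mul (-2)).congr_deriv ?_
  have h_pos_sub : Real.sin φ ^ 2 + (s - Real.cos φ) ^ 2 ≠ 0 := by positivity
  have h_pos_add : Real.sin φ ^ 2 + (s + Real.cos φ) ^ 2 ≠ 0 := by positivity
  rw [segPoly_eq_mul]
  simp only [id]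
  field_simp
  linear_combination (-4 : ℝ) * Real.sin_sq_add_cos_sq φ

theorem arctan_one_sub_cos_add_arctan_one_add_cos {φ : ℝ} (h_sin : 0 < Real.sin φ) :
    Real.arctan ((1 - Real.cos φ) / Real.sin φ) + Real.arctan ((1 + Real.cos φ) / Real.sin φ) =
      Real.pi / 2 := by
  have h_cos : Real.cos φ < 1 := by nlinarith [Real.sin_sq_add_cos_sq φ, Real.cos_le_one φ]
  have h_inv : (1 + Real.cos φ) / Real.sin φ = ((1 - Real.cos φ) / Real.sin φ)⁻¹ := by
    rw [inv_div, div_eq_div_iff h_sin.ne' (by linarith)]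
    linarith [Real.sin_sq_add_cos_sq φ]
  rw [h_inv, Real.arctan_inv_of_pos (div_pos (by linarith) h_sin)]
  ring

theorem primitive_realCoeffs_γ_one {φ : ℝ} (h_sin : 0 < Real.sin φ) :
    primitive (realCoeffs φ h_sin.ne').γ 1 = -Real.pi := by
  have h_extend : primitive (realCoeffs φ h_sin.ne').γ 1 =
      ∫ u in (0 : ℝ)..1, -4 * Real.sin φ * (u ^ 2 + 1) / segPoly φ u := by
    refine intervalIntegral.integral_congr fun u hu => ?_
    rw [uIcc_of_le zero_le_one] at hu
    exact IccExtend_of_mem zero_le_one (realCoeffs φ h_sin.ne').γ hu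
  have h_cont : Continuous fun u : ℝ => -4 * Real.sin φ * (u ^ 2 + 1) / segPoly φ u :=
    Continuous.div (by fun_prop) (continuous_segPoly φ) fun u => (segPoly_pos h_sin.ne' u).ne'
  rw [h_extend, intervalIntegral.integral_eq_sub_of_hasDerivAt
    (fun s _ => hasDerivAt_arctan_add_arctan h_sin.ne' s) (h_cont.intervalIntegrable 0 1),
    arctan_one_sub_cos_add_arctan_one_add_cos h_sin, zero_sub, neg_div, Real.arctan_neg, zero_add,
    neg_add_cancel]
  ring

theorem primitive_imagCoeffs_γ_one {φ : ℝ} (h_cos : 0 < Real.cos φ) :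
    primitive (imagCoeffs φ h_cos.ne').γ 1 = -Real.pi :=
  primitive_realCoeffs_γ_one (by rwa [Real.sin_pi_div_two_sub])

theorem ofReal_notMem_range_punct {φ : ℝ} (h_sin : Real.sin φ ≠ 0) (s : ℝ) :
    (s : ℂ) ∉ range (punct φ) := by
  rw [mem_range_punct_iff, ← ofReal_segPoly]
  exact ofReal_ne_zero.2 (segPoly_pos h_sin s).ne'

theorem ofReal_mul_I_notMem_range_punct {φ : ℝ} (h_cos : Real.cos φ ≠ 0) (s : ℝ) :
    (s : ℂ) * Complex.I ∉ range (punct φ) := by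
  rw [mem_range_punct_iff, ← ofReal_segPoly_pi_div_two_sub]
  exact ofReal_ne_zero.2 (segPoly_pos (by rwa [Real.sin_pi_div_two_sub]) s).ne'

end Segments

section Uniqueness

theorem eqOn_Icc_of_hasDerivWithinAt_clm {𝕜 E : Type*} [NontriviallyNormedField 𝕜]
    [NormedAddCommGroup E] [NormedSpace 𝕜 E] [NormedSpace ℝ E] {L : ℝ → E →L[𝕜] E} {a b : ℝ}
    (hL : ContinuousOn L (Icc a b)) {y z : ℝ → E}
    (hy : ∀ s ∈ Icc a b, HasDerivWithinAt y (L s (y s)) (Icc a b) s)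
    (hz : ∀ s ∈ Icc a b, HasDerivWithinAt z (L s (z s)) (Icc a b) s) (h_init : y a = z a) :
    EqOn y z (Icc a b) := by
  obtain ⟨K, hK⟩ := isCompact_Icc.exists_bound_of_continuousOn hL
  have h_lip : ∀ s ∈ Ico a b, LipschitzOnWith K.toNNReal (L s) univ := fun s hs =>
    ((L s).lipschitz.weaken (by
      rw [← norm_toNNReal]
      exact Real.toNNReal_le_toNNReal (hK s (Ico_subset_Icc_self hs)))).lipschitzOnWith
  have h_right : ∀ {f : ℝ → E}, (∀ s ∈ Icc a b, HasDerivWithinAt f (L s (f s)) (Icc a b) s) →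
      ∀ s ∈ Ico a b, HasDerivWithinAt f (L s (f s)) (Ici s) s := fun hf s hs =>
    (hf s (Ico_subset_Icc_self hs)).mono_of_mem_nhdsWithin (Icc_mem_nhdsGE_of_mem hs)
  exact ODE_solution_unique_of_mem_Icc_right h_lip
    (fun s hs => (hy s hs).continuousWithinAt) (h_right hy) (fun _ _ => mem_univ _)
    (fun s hs => (hz s hs).continuousWithinAt) (h_right hz) (fun _ _ => mem_univ _) h_init

theorem IsFrameAlong.eq_at_one {E : ℂ → M2} {v : ℂ} {Y Y' : ℝ → M2}
    (hE : ContinuousOn (fun s : ℝ => v • E (s * v)) (Icc 0 1)) (hY : IsFrameAlong E v Y)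
    (hY' : IsFrameAlong E v Y') : Y 1 = Y' 1 := by
  let L (s : ℝ) : (Fin 2 → ℂ) →L[ℂ] (Fin 2 → ℂ) := ∑ k, ∑ j, (v • E (s * v)) k j •
    ContinuousLinearMap.single ℂ (fun _ => ℂ) j ∘L ContinuousLinearMap.proj k
  have hL : ContinuousOn L (Icc 0 1) := by
    refine continuousOn_finsetSum _ fun k _ => continuousOn_finsetSum _ fun j _ => ?_
    exact ((continuous_id.matrix_elem k j).comp_continuousOn hE).smul continuousOn_const
  have h_rows : ∀ {Z : ℝ → M2}, IsFrameAlong E v Z → ∀ i, ∀ s ∈ Icc (0 : ℝ) 1,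
      HasDerivWithinAt (fun s => Z s i) (L s (Z s i)) (Icc 0 1) s := fun hZ i s hs => by
    refine hasDerivWithinAt_pi.2 fun j => (hZ.2 s hs i j).congr_deriv ?_
    rw [← Matrix.mul_smul, Matrix.mul_apply]
    fin_cases j <;> simp [L, mul_comm]
  have h_init : ∀ i, Y 0 i = Y' 0 i := by simp [hY.1, hY'.1]
  funext i
  exact eqOn_Icc_of_hasDerivWithinAt_clm hL (h_rows hY i) (h_rows hY' i) (h_init i)
    (right_mem_Icc.2 zero_le_one)

theorem principal_eq {E : ℂ → M2} {v : ℂ} {Y : ℝ → M2}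
    (hE : ContinuousOn (fun s : ℝ => v • E (s * v)) (Icc 0 1)) (hY : IsFrameAlong E v Y) :
    principal E v = Y 1 := by
  have h_exists : ∃ Y, IsFrameAlong E v Y := ⟨Y, hY⟩
  rw [principal, dif_pos h_exists]
  exact h_exists.choose_spec.eq_at_one hE hY

end Uniqueness

section Frames

open scoped unitInterval

variable {ρ : ℝ} [Fact (1 < ρ)]

/-- Conjugation of `N` by `diag(1, d)`. It turns the potential along the segment from `0` to `i`,
where the coefficients are not real, into one with real coefficients. -/
def conjDiag (d : ℂ) (N : M2) : M2 := !![N 0 0, N 0 1 * d⁻¹; d * N 1 0, N 1 1]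

theorem conjDiag_one_right {d : ℂ} : conjDiag d 1 = 1 := by
  rw [conjDiag, Matrix.one_fin_two]
  simp

theorem conjDiag_mul {d : ℂ} (hd : d ≠ 0) (M N : M2) :
    conjDiag d (M * N) = conjDiag d M * conjDiag d N := by
  ext i j
  fin_cases i <;> fin_cases j <;> simp [conjDiag, Matrix.mul_apply, Fin.sum_univ_two] <;>
    field_simp

theorem hasDerivAt_conjDiag_apply (d : ℂ) {N : ℝ → M2} {N' : M2} {s : ℝ}
    (hN : ∀ i j, HasDerivAt (fun s => N s i j) (N' i j) s) (i j : Fin 2) :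
    HasDerivAt (fun s => conjDiag d (N s) i j) (conjDiag d N' i j) s := by
  fin_cases i <;> fin_cases j
  · exact hN 0 0
  · exact (hN 0 1).mul_const d⁻¹
  · exact (hN 1 0).const_mul d
  · exact hN 1 1

/-- The value at the spectral parameter `z` of the frame over the Banach algebra of loops, with
rows the solutions of `y' = t y X`. -/
def frameMat (κ : SegmentCoeffs) (t : ℝ) (w : RealLoop ρ × RealLoop ρ × RealLoop ρ) (z : ℂ)
    (s : ℝ) : M2 :=
  let y₁ := frameRow κ t w (1, 0) s
  let y₂ := frameRow κ t w (0, 1) s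
  !![RealLoop.eval z y₁.1, RealLoop.eval z y₁.2; RealLoop.eval z y₂.1, RealLoop.eval z y₂.2]

variable {κ : SegmentCoeffs} {t : ℝ} {a b c : RealLoop ρ} {z : ℂ}

theorem frameMat_zero (κ : SegmentCoeffs) (t : ℝ) (w : RealLoop ρ × RealLoop ρ × RealLoop ρ)
    (hz : ‖z‖ = 1) : frameMat κ t w z 0 = 1 := by
  simp only [frameMat, frameRow_zero, RealLoop.eval_one hz, map_zero, Matrix.one_fin_two]

theorem hasDerivAt_frameMat (h : FrameSolvable κ t (a, b, c)) (hz : ‖z‖ = 1) (s : I)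
    (i j : Fin 2) :
    HasDerivAt (fun s => frameMat κ t (a, b, c) z s i j)
      ((frameMat κ t (a, b, c) z s * ((t : ℂ) • formMat (κ.α s) (κ.β s) (κ.γ s)
        (RealLoop.eval z a) (RealLoop.eval z b) (RealLoop.eval z c))) i j) s := by
  have h_row := hasDerivAt_frameRow h
  have h_fst (e : RealLoop ρ × RealLoop ρ) := (RealLoop.eval (ρ := ρ) z ∘L
    ContinuousLinearMap.fst ℝ _ (RealLoop ρ)).hasFDerivAt.comp_hasDerivAt (s : ℝ) (h_row e s)
  have h_snd (e : RealLoop ρ × RealLoop ρ) := (RealLoop.eval (ρ := ρ) z ∘L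
    ContinuousLinearMap.snd ℝ (RealLoop ρ) _).hasFDerivAt.comp_hasDerivAt (s : ℝ) (h_row e s)
  rw [Matrix.mul_smul, Matrix.smul_apply, Matrix.mul_apply, Fin.sum_univ_two]
  fin_cases i <;> fin_cases j
  · refine (h_fst (1, 0)).congr_deriv ?_
    simp [frameMat, formMat, RealLoop.eval_mul hz]
    ring
  · refine (h_snd (1, 0)).congr_deriv ?_
    simp [frameMat, formMat, RealLoop.eval_mul hz, sub_eq_add_neg]
    ring
  · refine (h_fst (0, 1)).congr_deriv ?_
    simp [frameMat, formMat, RealLoop.eval_mul hz]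
    ring
  · refine (h_snd (0, 1)).congr_deriv ?_
    simp [frameMat, formMat, RealLoop.eval_mul hz, sub_eq_add_neg]
    ring

section Principal

variable (h : FrameSolvable κ t (a, b, c)) (hz : ‖z‖ = 1) {E : ℂ → M2} {v d : ℂ} (hd : d ≠ 0)
  (hE : ∀ s : I, v • E ((s : ℝ) * v) = conjDiag d ((t : ℂ) • formMat (κ.α s) (κ.β s) (κ.γ s)
    (RealLoop.eval z a) (RealLoop.eval z b) (RealLoop.eval z c)))

include hE in
theorem continuousOn_of_eq_conjDiag : ContinuousOn (fun s : ℝ => v • E (s * v)) (Icc 0 1) := by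
  rw [continuousOn_iff_continuous_domRestrict]
  refine (continuous_matrix fun i j => ?_ : Continuous fun s : I => conjDiag d ((t : ℂ) • formMat
    (κ.α s) (κ.β s) (κ.γ s) (RealLoop.eval z a) (RealLoop.eval z b)
    (RealLoop.eval z c))).congr fun s => (hE s).symm
  fin_cases i <;> fin_cases j
  · exact (by fun_prop : Continuous fun s : I => (t : ℂ) * (κ.α s * RealLoop.eval z a))
  · exact (by fun_prop : Continuous fun s : I =>
      (t : ℂ) * (κ.β s * RealLoop.eval z b + κ.γ s * RealLoop.eval z c) * d⁻¹)
  · exact (by fun_prop : Continuous fun s : I =>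
      d * ((t : ℂ) * (κ.β s * RealLoop.eval z b - κ.γ s * RealLoop.eval z c)))
  · exact (by fun_prop : Continuous fun s : I => (t : ℂ) * -(κ.α s * RealLoop.eval z a))

include h hz hd hE in
theorem isFrameAlong_conjDiag :
    IsFrameAlong E v fun s => conjDiag d (frameMat κ t (a, b, c) z s) := by
  refine ⟨by simp only [frameMat_zero κ t _ hz, conjDiag_one_right], fun s hs i j => ?_⟩
  rw [← Matrix.mul_smul, hE ⟨s, hs⟩, ← conjDiag_mul hd]
  exact (hasDerivAt_conjDiag_apply d (hasDerivAt_frameMat h hz ⟨s, hs⟩) i j).hasDerivWithinAt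

include h hz hd hE in
theorem principal_eq_conjDiag : principal E v = conjDiag d (frameMat κ t (a, b, c) z 1) :=
  principal_eq (continuousOn_of_eq_conjDiag hE) (isFrameAlong_conjDiag h hz hd hE)

end Principal

theorem ofReal_mul_eval_hatLoop (κ : SegmentCoeffs) (t : ℝ)
    (w : RealLoop ρ × RealLoop ρ × RealLoop ρ) (hz : ‖z‖ = 1) :
    let P := frameMat κ t w z 1
    t * RealLoop.eval z (hatLoop κ t w) = P 0 0 * P 1 0 - P 0 1 * P 1 1 := by
  have h_smul := congrArg (RealLoop.eval z) (smul_hatLoop κ t w)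
  rwa [map_smul, map_sub, RealLoop.eval_mul hz, RealLoop.eval_mul hz, real_smul] at h_smul

end Frames

/-! ## The monodromy data as loops -/

section MonodromyLoops

variable {ρ : ℝ} [Fact (1 < ρ)]

/-- The loop `a` of `Param.a`. -/
def loopA (x : Param ρ) : RealLoop ρ :=
  (1 / 2 : ℝ) • (RealLoop.monomial (-1) - RealLoop.monomial 1) + toRealLoop x.1

/-- The loop `b` of `Param.b`. -/
def loopB (φ : ℝ) (x : Param ρ) : RealLoop ρ :=
  (-(1 / 2) * Real.sin φ) • (RealLoop.monomial (-1) + RealLoop.monomial 1) + toRealLoop x.2.1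

/-- The loop `c` of `Param.c`. -/
def loopC (φ : ℝ) (x : Param ρ) : RealLoop ρ :=
  (-(1 / 2) * Real.cos φ) • (RealLoop.monomial (-1) + RealLoop.monomial 1) + toRealLoop x.2.2.1

section Evaluation

variable {z : ℂ} (hz : ‖z‖ = 1)

include hz

theorem eval_loopA (x : Param ρ) : RealLoop.eval z (loopA x) = x.a z := by
  simp [loopA, Param.a, RealLoop.eval_monomial hz, eval_toRealLoop hz]

theorem eval_loopB (φ : ℝ) (x : Param ρ) : RealLoop.eval z (loopB φ x) = x.b φ z := by
  simp [loopB, Param.b, RealLoop.eval_monomial hz, eval_toRealLoop hz]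
  ring

theorem eval_loopC (φ : ℝ) (x : Param ρ) : RealLoop.eval z (loopC φ x) = x.c φ z := by
  simp [loopC, Param.c, RealLoop.eval_monomial hz, eval_toRealLoop hz]
  ring

end Evaluation

/-- The loops `(a, b, c)` of the frame equation along the segment from `0` to `1`. -/
def realEntries (φ : ℝ) (x : Param ρ) : RealLoop ρ × RealLoop ρ × RealLoop ρ :=
  (x.r • loopA x, x.r • loopB φ x, x.r • loopC φ x)

/-- The loops `(a, b, c)` of the frame equation along the segment from `0` to `i`; see
`imagCoeffs`. -/
def imagEntries (φ : ℝ) (x : Param ρ) : RealLoop ρ × RealLoop ρ × RealLoop ρ :=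
  (-(x.r • loopA x), x.r • loopC φ x, x.r • loopB φ x)

variable {φ t : ℝ} {x : Param ρ} {z : ℂ}

theorem pFun_eq_ofReal_mul_eval (h_sin : Real.sin φ ≠ 0)
    (h : FrameSolvable (realCoeffs φ h_sin) t (realEntries φ x)) (hz : ‖z‖ = 1) :
    pFun φ t x z =
      t * RealLoop.eval z (hatLoop (realCoeffs φ h_sin) t (realEntries φ x)) := by
  have h_principal : principal (potential φ t x z) 1 =
      conjDiag 1 (frameMat (realCoeffs φ h_sin) t (realEntries φ x) z 1) :=
    principal_eq_conjDiag h hz one_ne_zero fun s => by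
      rw [mul_one, potential_eq φ t x z (ofReal_notMem_range_punct h_sin s),
        coefA_ofReal h_sin, coefB_ofReal h_sin, coefC_ofReal h_sin]
      ext i j
      fin_cases i <;> fin_cases j <;>
        simp [conjDiag, formMat, eval_loopA hz, eval_loopB hz, eval_loopC hz] <;> ring
  rw [ofReal_mul_eval_hatLoop _ _ _ hz, pFun, h_principal]
  simp [conjDiag, realEntries]

theorem qFun_eq_ofReal_mul_eval (h_cos : Real.cos φ ≠ 0)
    (h : FrameSolvable (imagCoeffs φ h_cos) t (imagEntries φ x)) (hz : ‖z‖ = 1) :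
    qFun φ t x z =
      t * RealLoop.eval z (hatLoop (imagCoeffs φ h_cos) t (imagEntries φ x)) := by
  have h_principal : principal (potential φ t x z) I =
      conjDiag (-I) (frameMat (imagCoeffs φ h_cos) t (imagEntries φ x) z 1) :=
    principal_eq_conjDiag h hz (neg_ne_zero.2 I_ne_zero) fun s => by
      rw [potential_eq φ t x z (ofReal_mul_I_notMem_range_punct h_cos s),
        coefA_ofReal_mul_I h_cos, coefB_ofReal_mul_I h_cos, coefC_ofReal_mul_I h_cos]
      ext i j
      fin_cases i <;> fin_cases j <;>
        simp [conjDiag, formMat, eval_loopA hz, eval_loopB hz, eval_loopC hz]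
      · linear_combination (x.r * t * (imagCoeffs φ h_cos).α s * x.a z : ℂ) * I_sq
      · ring
      · ring
      · linear_combination (-(x.r * t * (imagCoeffs φ h_cos).α s * x.a z) : ℂ) * I_sq
  rw [ofReal_mul_eval_hatLoop _ _ _ hz, qFun, h_principal]
  generalize frameMat (imagCoeffs φ h_cos) t (imagEntries φ x) z 1 = N
  simp only [conjDiag, Matrix.of_apply, Matrix.cons_val', Matrix.cons_val_zero,
    Matrix.cons_val_one, Matrix.cons_val_fin_one, inv_neg, inv_I, neg_neg]
  linear_combination (-(N 0 0 * N 1 0) + N 0 1 * N 1 1) * I_sq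

section DividedDifference

variable {𝕜 E : Type*} [NontriviallyNormedField 𝕜] [NormedAddCommGroup E] [NormedSpace 𝕜 E]
  {f g : 𝕜 → E}

theorem hasDerivAt_zero_of_eventually_eq_smul (h_near : ∀ᶠ s in 𝓝 0, f s = s • g s)
    (hg : ContinuousAt g 0) : HasDerivAt f (g 0) 0 := by
  have hf_zero : f 0 = 0 := by simpa using h_near.self_of_nhds
  refine hasDerivAt_iff_tendsto_slope.2 ((hg.tendsto.mono_left nhdsWithin_le_nhds).congr' ?_)
  filter_upwards [h_near.filter_mono nhdsWithin_le_nhds, self_mem_nhdsWithin] with s hs hs_ne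
  rw [slope_def_module, hf_zero, sub_zero, sub_zero, hs, inv_smul_smul₀ hs_ne]

theorem dslope_zero_eq_of_eq_smul {t : 𝕜} (h_near : ∀ᶠ s in 𝓝 0, f s = s • g s)
    (ht : f t = t • g t) (hg : ContinuousAt g 0) : dslope f 0 t = g t := by
  rcases eq_or_ne t 0 with rfl | ht_ne
  · rw [dslope_same, (hasDerivAt_zero_of_eventually_eq_smul h_near hg).deriv]
  · have hf_zero : f 0 = 0 := by simpa using h_near.self_of_nhds
    rw [dslope_of_ne _ ht_ne, slope_def_module, hf_zero, sub_zero, sub_zero, ht,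
      inv_smul_smul₀ ht_ne]

end DividedDifference

theorem dslope_eq_eval_hatLoop {κ : SegmentCoeffs} {w : RealLoop ρ × RealLoop ρ × RealLoop ρ}
    {f : ℝ → ℂ}
    (hf : ∀ s : ℝ, FrameSolvable κ s w → f s = s * RealLoop.eval z (hatLoop κ s w))
    (ht : FrameSolvable κ t w) : dslope f 0 t = RealLoop.eval z (hatLoop κ t w) := by
  have h_pair : Continuous fun s : ℝ => (s, w) := by fun_prop
  have h_near : ∀ᶠ s in 𝓝 (0 : ℝ), FrameSolvable κ s w :=
    ((isOpen_frameSolvable κ).preimage h_pair).mem_nhds (frameSolvable_zero κ w)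
  have h_cont : ContinuousAt (fun s : ℝ => hatLoop κ s w) 0 :=
    (contDiffAt_hatLoop (frameSolvable_zero κ w)).continuousAt.comp
      (f := fun s : ℝ => (s, w)) h_pair.continuousAt
  exact dslope_zero_eq_of_eq_smul (g := fun s : ℝ => RealLoop.eval z (hatLoop κ s w))
    (h_near.mono hf) (hf t ht) ((RealLoop.eval (ρ := ρ) z).continuous.continuousAt.comp h_cont)

variable (φ) (h_sin : Real.sin φ ≠ 0) (h_cos : Real.cos φ ≠ 0)

/-- The loop `\hat 𝔭` at `(t, x) = q`. -/
def pLoop (q : ℝ × Param ρ) : RealLoop ρ :=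
  hatLoop (realCoeffs φ h_sin) q.1 (realEntries φ q.2)

/-- The loop `\hat 𝔮` at `(t, x) = q`. -/
def qLoop (q : ℝ × Param ρ) : RealLoop ρ :=
  hatLoop (imagCoeffs φ h_cos) q.1 (imagEntries φ q.2)

/-- Both frame equations at `(t, x) = q` satisfy the condition for solvability. -/
def FramesSolvable (q : ℝ × Param ρ) : Prop :=
  FrameSolvable (realCoeffs φ h_sin) q.1 (realEntries φ q.2) ∧
    FrameSolvable (imagCoeffs φ h_cos) q.1 (imagEntries φ q.2)

variable {φ h_sin h_cos}

theorem pHat_eq_eval_pLoop (h : FramesSolvable φ h_sin h_cos (t, x)) (hz : ‖z‖ = 1) :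
    pHat φ t x z = RealLoop.eval z (pLoop φ h_sin (t, x)) :=
  dslope_eq_eval_hatLoop (fun _ hs => pFun_eq_ofReal_mul_eval h_sin hs hz) h.1

theorem qHat_eq_eval_qLoop (h : FramesSolvable φ h_sin h_cos (t, x)) (hz : ‖z‖ = 1) :
    qHat φ t x z = RealLoop.eval z (qLoop φ h_cos (t, x)) :=
  dslope_eq_eval_hatLoop (fun _ hs => qFun_eq_ofReal_mul_eval h_cos hs hz) h.2

end MonodromyLoops

/-! ## The monodromy problem as an equation between Banach spaces -/

section MonodromyMap

variable {ρ : ℝ} [Fact (1 < ρ)]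

/-- The nonnegative loop whose coefficients are `f_k - f_{-k}` for `k ≥ 1`, shifted by one. It
records the failure of `f = f^*`. -/
def skewPart : RealLoop ρ →L[ℝ] WRNonneg ρ :=
  nonnegPart ∘L ContinuousLinearMap.mul ℝ (RealLoop ρ) (RealLoop.monomial (-1)) ∘L
    (ContinuousLinearMap.id ℝ (RealLoop ρ) - RealLoop.reverse)

theorem skewPart_apply (f : RealLoop ρ) :
    skewPart f = nonnegPart (RealLoop.monomial (-1) * (f - RealLoop.reverse f)) := rfl

theorem coeff_toRealLoop_skewPart (f : RealLoop ρ) {k : ℤ} (hk : 0 ≤ k) :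
    (toRealLoop (skewPart f)).coeff k = f.coeff (k + 1) - f.coeff (-(k + 1)) := by
  rw [skewPart_apply, coeff_toRealLoop_nonnegPart, if_pos hk, RealLoop.coeff_monomial_mul,
    RealLoop.coeff_sub, RealLoop.coeff_reverse, sub_neg_eq_add]

theorem skewPart_eq_zero_iff (f : RealLoop ρ) : skewPart f = 0 ↔ RealLoop.reverse f = f := by
  constructor
  · intro h
    have h_pos : ∀ k : ℤ, 0 < k → f.coeff k = f.coeff (-k) := fun k hk => by
      have h_coeff := coeff_toRealLoop_skewPart f (k := k - 1) (by lia)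
      rw [h, map_zero, RealLoop.coeff_zero, sub_add_cancel] at h_coeff
      exact (sub_eq_zero.1 h_coeff.symm)
    refine RealLoop.ext fun k => ?_
    rw [RealLoop.coeff_reverse]
    rcases lt_trichotomy k 0 with hk | rfl | hk
    · simpa using h_pos (-k) (by lia)
    · simp
    · exact (h_pos k hk).symm
  · intro h
    rw [skewPart_apply, h, sub_self, mul_zero, map_zero]

theorem skewPart_toRealLoop (h : WRNonneg ρ) : skewPart (toRealLoop h) = leftShift 1 h := by
  refine toRealLoop.injective (RealLoop.ext fun k => ?_)
  rcases lt_or_ge k 0 with hk | hk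
  · rw [toRealLoop_mem _ k hk, toRealLoop_mem _ k hk]
  · rw [coeff_toRealLoop_skewPart _ hk, toRealLoop_mem h (-(k + 1)) (by lia), sub_zero,
      coeff_toRealLoop_leftShift, if_pos hk, Nat.cast_one]

theorem conj_eval_eq_self_of_skewPart_eq_zero {f : RealLoop ρ} (hf : skewPart f = 0) {z : ℂ}
    (hz : ‖z‖ = 1) : conj (RealLoop.eval z f) = RealLoop.eval z f := by
  rw [← RealLoop.eval_reverse hz, (skewPart_eq_zero_iff f).1 hf]

theorem eval_eq_zero_iff_re_eq_zero_of_skewPart_eq_zero {f : RealLoop ρ} (hf : skewPart f = 0)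
    {z : ℂ} (hz : ‖z‖ = 1) : RealLoop.eval z f = 0 ↔ (RealLoop.eval z f).re = 0 := by
  rw [← conj_eq_iff_re.1 (conj_eval_eq_self_of_skewPart_eq_zero hf hz), ofReal_eq_zero, ofReal_re]

theorem sub_starLoop_eq_zero_iff {F : ℂ → ℂ} {f : RealLoop ρ}
    (hF : ∀ z : ℂ, ‖z‖ = 1 → F z = RealLoop.eval z f) :
    (∀ z ∈ Metric.sphere (0 : ℂ) 1, F z - starLoop F z = 0) ↔ skewPart f = 0 := by
  have h_star : ∀ z : ℂ, ‖z‖ = 1 → starLoop F z = conj (RealLoop.eval z f) := fun z hz => by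
    rw [starLoop, one_div, ← inv_eq_conj hz, inv_inv, hF z hz]
  refine ⟨fun h => (skewPart_eq_zero_iff f).2 (RealLoop.ext_of_eval fun z hz => ?_),
    fun h z hz => ?_⟩
  · have h_sub := h z (mem_sphere_zero_iff_norm.2 hz)
    rw [hF z hz, h_star z hz, sub_eq_zero] at h_sub
    rw [RealLoop.eval_reverse hz, ← h_sub]
  · rw [mem_sphere_zero_iff_norm] at hz
    rw [hF z hz, h_star z hz, conj_eval_eq_self_of_skewPart_eq_zero h hz, sub_self]

/-- The loop `λ (𝒦 + 1)`, which has only nonnegative powers of `λ`. -/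
def detLoop (φ : ℝ) (x : Param ρ) : RealLoop ρ :=
  (1 - x.r ^ 2) • RealLoop.monomial 1 + x.r ^ 2 • ((1 - RealLoop.monomial 2) * toRealLoop x.1 +
    (1 + RealLoop.monomial 2) * (Real.sin φ • toRealLoop x.2.1 + Real.cos φ • toRealLoop x.2.2.1) +
    RealLoop.monomial 1 * (toRealLoop x.1 ^ 2 - toRealLoop x.2.1 ^ 2 - toRealLoop x.2.2.1 ^ 2))

theorem eval_detLoop {z : ℂ} (hz : ‖z‖ = 1) (φ : ℝ) (x : Param ρ) :
    RealLoop.eval z (detLoop φ x) = z * (calK φ x z + 1) := by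
  have hz_ne : z ≠ 0 := norm_ne_zero_iff.1 (hz ▸ one_ne_zero)
  have h_pyth : (Real.sin φ : ℂ) ^ 2 + (Real.cos φ : ℂ) ^ 2 = 1 := by
    exact_mod_cast Real.sin_sq_add_cos_sq φ
  rw [calK, Matrix.det_fin_two]
  simp only [detLoop, map_add, map_sub, map_smul, RealLoop.eval_mul hz, RealLoop.eval_monomial hz,
    RealLoop.eval_one hz, eval_toRealLoop hz, real_smul, residue, Param.a, Param.b, Param.c,
    Matrix.smul_apply, Matrix.of_apply, Matrix.cons_val', Matrix.cons_val_zero,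
    Matrix.cons_val_one, Matrix.cons_val_fin_one, smul_eq_mul, zpow_one, ofReal_sub, ofReal_mul,
    ofReal_one, sq]
  generalize (Real.sin φ : ℂ) = S at h_pyth ⊢
  field_simp
  ring_nf
  simp only [I_sq]
  linear_combination x.r ^ 2 * (z ^ 2 + 1) ^ 2 * h_pyth

theorem detLoop_mem_nonnegLoops (φ : ℝ) (x : Param ρ) : detLoop φ x ∈ nonnegLoops ρ := by
  have hX : ∀ n : ℤ, 0 ≤ n → RealLoop.monomial n ∈ nonnegLoops ρ :=
    fun n hn => monomial_mem_nonnegLoops hn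
  have hx := toRealLoop_mem (ρ := ρ)
  refine add_mem (Subalgebra.smul_mem _ (hX 1 zero_le_one) _) (Subalgebra.smul_mem _ (add_mem
    (add_mem (mul_mem (sub_mem (one_mem _) (hX 2 zero_le_two)) (hx _))
      (mul_mem (add_mem (one_mem _) (hX 2 zero_le_two))
        (add_mem (Subalgebra.smul_mem _ (hx _) _) (Subalgebra.smul_mem _ (hx _) _))))
    (mul_mem (hX 1 zero_le_one) (sub_mem (sub_mem (pow_mem (hx _) 2) (pow_mem (hx _) 2))
      (pow_mem (hx _) 2)))) _)

theorem nonnegPart_detLoop_eq_zero_iff (φ : ℝ) (x : Param ρ) :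
    nonnegPart (detLoop φ x) = 0 ↔ ∀ z ∈ Metric.sphere (0 : ℂ) 1, calK φ x z = -1 := by
  rw [nonnegPart_eq_zero_iff_of_mem (detLoop_mem_nonnegLoops φ x)]
  constructor
  · intro h z hz
    rw [mem_sphere_zero_iff_norm] at hz
    have h_eval := eval_detLoop hz φ x
    rw [h, map_zero, eq_comm, mul_eq_zero] at h_eval
    exact eq_neg_of_add_eq_zero_left
      (h_eval.resolve_left (norm_ne_zero_iff.1 (hz ▸ one_ne_zero)))
  · intro h
    refine RealLoop.ext_of_eval fun z hz => ?_
    rw [eval_detLoop hz, h z (mem_sphere_zero_iff_norm.2 hz), neg_add_cancel, mul_zero, map_zero]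

variable (φ : ℝ) (h_sin : Real.sin φ ≠ 0) (h_cos : Real.cos φ ≠ 0)

/-- The map `(t, x) ↦ (ℱ, 𝒢, 𝒦 + 1, ℋ₁, ℋ₂)`, the first three components being encoded as
nonnegative loops. -/
def monodromyMap (q : ℝ × Param ρ) : Param ρ :=
  (skewPart (pLoop φ h_sin q), skewPart (qLoop φ h_cos q), nonnegPart (detLoop φ q.2),
    (RealLoop.eval (exp (I * q.2.θ)) (pLoop φ h_sin q)).re,
    (RealLoop.eval (exp (I * q.2.θ)) (qLoop φ h_cos q)).re)

variable {φ h_sin h_cos}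

theorem solvesMonodromyProblem_iff {t : ℝ} {x : Param ρ}
    (h : FramesSolvable φ h_sin h_cos (t, x)) :
    SolvesMonodromyProblem φ t x ↔
      x.θ ∈ Ioo 0 Real.pi ∧ monodromyMap φ h_sin h_cos (t, x) = 0 := by
  have h_unit := norm_exp_I_mul_ofReal x.θ
  have hF := sub_starLoop_eq_zero_iff fun z hz => pHat_eq_eval_pLoop (z := z) h hz
  have hG := sub_starLoop_eq_zero_iff fun z hz => qHat_eq_eval_qLoop (z := z) h hz
  have hK := nonnegPart_detLoop_eq_zero_iff φ x
  have hH₁ (h_skew : skewPart (pLoop φ h_sin (t, x)) = 0) :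
      calH₁ φ t x = 0 ↔ (RealLoop.eval (exp (I * x.θ)) (pLoop φ h_sin (t, x))).re = 0 := by
    rw [calH₁, pHat_eq_eval_pLoop h h_unit,
      eval_eq_zero_iff_re_eq_zero_of_skewPart_eq_zero h_skew h_unit]
  have hH₂ (h_skew : skewPart (qLoop φ h_cos (t, x)) = 0) :
      calH₂ φ t x = 0 ↔ (RealLoop.eval (exp (I * x.θ)) (qLoop φ h_cos (t, x))).re = 0 := by
    rw [calH₂, qHat_eq_eval_qLoop h h_unit,
      eval_eq_zero_iff_re_eq_zero_of_skewPart_eq_zero h_skew h_unit]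
  simp only [monodromyMap, Prod.mk_eq_zero]
  constructor
  · rintro ⟨hF_eq, hG_eq, hK_eq, hθ, hH₁_eq, hH₂_eq⟩
    have h_p := hF.1 hF_eq
    have h_q := hG.1 hG_eq
    exact ⟨hθ, h_p, h_q, hK.2 hK_eq, (hH₁ h_p).1 hH₁_eq, (hH₂ h_q).1 hH₂_eq⟩
  · rintro ⟨hθ, h_p, h_q, h_det, h_p_re, h_q_re⟩
    exact ⟨hF.2 h_p, hG.2 h_q, hK.1 h_det, hθ, (hH₁ h_p).2 h_p_re, (hH₂ h_q).2 h_q_re⟩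

end MonodromyMap

/-! ## The linearization at the central value -/

section Linearization

open RealLoop

variable {ρ : ℝ} [Fact (1 < ρ)]

/-- The loop `k + λ g`. -/
def consLoop (k : ℝ) (g : WRNonneg ρ) : WRNonneg ρ := nonnegPart (k • 1 + monomial 1 * toRealLoop g)

theorem toRealLoop_consLoop (k : ℝ) (g : WRNonneg ρ) :
    toRealLoop (consLoop k g) = k • 1 + monomial 1 * toRealLoop g :=
  toRealLoop_nonnegPart (add_mem (Subalgebra.smul_mem _ (one_mem _) k)
    (mul_mem (monomial_mem_nonnegLoops zero_le_one) (toRealLoop_mem g)))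

theorem leftShift_consLoop (k : ℝ) (g : WRNonneg ρ) : leftShift 1 (consLoop k g) = g := by
  refine toRealLoop.injective (RealLoop.ext fun j => ?_)
  rw [coeff_toRealLoop_leftShift, toRealLoop_consLoop, coeff_add, coeff_smul, one_eq_monomial,
    coeff_monomial, coeff_monomial_mul, Nat.cast_one, add_sub_cancel_right]
  split_ifs with hj
  · rw [Pi.single_eq_of_ne (by lia), mul_zero, zero_add]
  · exact (toRealLoop_mem g j (not_le.1 hj)).symm

theorem consLoop_leftShift (h : WRNonneg ρ) :
    consLoop ((toRealLoop h).coeff 0) (leftShift 1 h) = h := by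
  refine toRealLoop.injective (RealLoop.ext fun j => ?_)
  rw [toRealLoop_consLoop, coeff_add, coeff_smul, one_eq_monomial, coeff_monomial,
    coeff_monomial_mul, coeff_toRealLoop_leftShift, Nat.cast_one, sub_add_cancel]
  rcases lt_trichotomy j 0 with hj | rfl | hj
  · rw [Pi.single_eq_of_ne hj.ne, if_neg (by lia), toRealLoop_mem h j hj, mul_zero, zero_add]
  · rw [Pi.single_eq_same, if_neg (by lia), mul_one, add_zero]
  · rw [Pi.single_eq_of_ne hj.ne', if_pos (by lia), mul_zero, zero_add]

theorem consLoop_zero_zero : consLoop 0 (0 : WRNonneg ρ) = 0 := by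
  rw [consLoop, zero_smul, map_zero, mul_zero, add_zero, map_zero]

/-- The derivative of `detLoop φ` at the central value. -/
def linearizedDetLoop (φ : ℝ) (h : Param ρ) : RealLoop ρ :=
  (1 - monomial 2) * toRealLoop h.1 + (1 + monomial 2) * (Real.sin φ • toRealLoop h.2.1 +
    Real.cos φ • toRealLoop h.2.2.1) - (2 * h.r) • monomial 1

/-- The derivative of `x ↦ monodromyMap φ _ _ (0, x)` at the central value. -/
def linearizedMonodromyMap (φ : ℝ) (h : Param ρ) : Param ρ :=
  ((2 * Real.pi) • leftShift 1 h.2.2.1, (2 * Real.pi) • leftShift 1 h.2.1,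
    nonnegPart (linearizedDetLoop φ h),
    2 * Real.pi * (Real.cos φ * h.θ + (eval I (toRealLoop h.2.2.1)).re),
    2 * Real.pi * (Real.sin φ * h.θ + (eval I (toRealLoop h.2.1)).re))

theorem linearizedDetLoop_mem_nonnegLoops (φ : ℝ) (h : Param ρ) :
    linearizedDetLoop φ h ∈ nonnegLoops ρ := by
  have hX : ∀ n : ℤ, 0 ≤ n → monomial n ∈ nonnegLoops ρ := fun n hn => monomial_mem_nonnegLoops hn
  have hh := toRealLoop_mem (ρ := ρ)
  exact sub_mem (add_mem (mul_mem (sub_mem (one_mem _) (hX 2 zero_le_two)) (hh _))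
    (mul_mem (add_mem (one_mem _) (hX 2 zero_le_two))
      (add_mem (Subalgebra.smul_mem _ (hh _) _) (Subalgebra.smul_mem _ (hh _) _))))
    (Subalgebra.smul_mem _ (hX 1 zero_le_one) _)

theorem linearizedDetLoop_consLoop (φ : ℝ) (a b c : WRNonneg ρ) (β γ r θ : ℝ) :
    linearizedDetLoop φ (a, consLoop β b, consLoop γ c, r, θ) =
      (1 - monomial 2) * toRealLoop (a - consLoop (Real.sin φ * β + Real.cos φ * γ)
        (Real.sin φ • b + Real.cos φ • c)) +
      toRealLoop ((2 : ℝ) • consLoop 0 (Real.sin φ • b + Real.cos φ • c)) +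
      ((2 * (Real.sin φ * β + Real.cos φ * γ)) • 1 + (-(2 * r)) • monomial 1) := by
  simp only [linearizedDetLoop, Param.r, map_sub, map_add, map_smul, toRealLoop_consLoop,
    Algebra.smul_def, map_mul, map_neg, map_ofNat, map_zero]
  ring

theorem nonnegPart_linearizedDetLoop_consLoop_eq_iff (φ : ℝ) (a b c K : WRNonneg ρ)
    (β γ r θ : ℝ) :
    nonnegPart (linearizedDetLoop φ (a, consLoop β b, consLoop γ c, r, θ)) = K ↔
      (1 - monomial 2) * toRealLoop (a - consLoop (Real.sin φ * β + Real.cos φ * γ)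
        (Real.sin φ • b + Real.cos φ • c)) =
      toRealLoop (K - (2 : ℝ) • consLoop 0 (Real.sin φ • b + Real.cos φ • c)) +
      ((-(2 * (Real.sin φ * β + Real.cos φ * γ))) • 1 + (2 * r) • monomial 1) := by
  rw [← toRealLoop.injective.eq_iff,
    toRealLoop_nonnegPart (linearizedDetLoop_mem_nonnegLoops φ _), linearizedDetLoop_consLoop,
    map_sub _ K, neg_smul, neg_smul]
  constructor <;> intro h
  · rw [← h]
    abel
  · rw [h]
    abel

theorem re_eval_I_consLoop (k : ℝ) (g : WRNonneg ρ) :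
    (eval I (toRealLoop (consLoop k g))).re = k + (eval I (monomial 1 * toRealLoop g)).re := by
  rw [toRealLoop_consLoop, map_add, map_smul, eval_one norm_I, add_re, real_smul, mul_one,
    ofReal_re]

theorem trig_system_iff (φ p q κ θ β γ : ℝ) :
    (Real.cos φ * θ + γ = p ∧ Real.sin φ * θ + β = q ∧ Real.sin φ * β + Real.cos φ * γ = κ) ↔
      θ = Real.cos φ * p + Real.sin φ * q - κ ∧ γ = p - Real.cos φ * θ ∧
        β = q - Real.sin φ * θ := by
  have h_pyth := Real.sin_sq_add_cos_sq φ
  constructor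
  · rintro ⟨rfl, rfl, rfl⟩
    refine ⟨?_, by ring, by ring⟩
    linear_combination -θ * h_pyth
  · rintro ⟨hθ, rfl, rfl⟩
    refine ⟨by ring, by ring, ?_⟩
    linear_combination -θ * h_pyth - hθ

theorem eq_zero_of_linearizedMonodromyMap_eq_zero {φ : ℝ} {h : Param ρ}
    (hh : linearizedMonodromyMap φ h = 0) : h = 0 := by
  obtain ⟨a, b, c, r, θ⟩ := h
  simp only [linearizedMonodromyMap, Prod.mk_eq_zero, smul_eq_zero, mul_eq_zero, Real.pi_ne_zero,
    two_ne_zero, false_or, Param.θ] at hh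
  obtain ⟨hc, hb, h_det, h_p, h_q⟩ := hh
  obtain ⟨β, rfl⟩ : ∃ β, consLoop β 0 = b := ⟨_, hb ▸ consLoop_leftShift b⟩
  obtain ⟨γ, rfl⟩ : ∃ γ, consLoop γ 0 = c := ⟨_, hc ▸ consLoop_leftShift c⟩
  rw [nonnegPart_linearizedDetLoop_consLoop_eq_iff] at h_det
  simp only [smul_zero, add_zero, consLoop_zero_zero, sub_zero, map_zero, zero_add] at h_det
  obtain ⟨ha, hκ, hr⟩ := eq_zero_of_one_sub_sq_mul_eq h_det
  replace hκ : Real.sin φ * β + Real.cos φ * γ = 0 := by linarith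
  replace hr : r = 0 := by linarith
  simp only [re_eval_I_consLoop, map_zero, mul_zero, zero_re, add_zero] at h_p h_q
  obtain ⟨hθ, hγ, hβ⟩ := (trig_system_iff φ 0 0 0 θ β γ).1 ⟨h_p, h_q, hκ⟩
  replace hθ : θ = 0 := by simpa using hθ
  replace hγ : γ = 0 := by simpa [hθ] using hγ
  replace hβ : β = 0 := by simpa [hθ] using hβ
  rw [hκ, consLoop_zero_zero, sub_zero] at ha
  rw [ha, hβ, hγ, hr, hθ, consLoop_zero_zero]
  rfl

theorem linearizedMonodromyMap_surjective (φ : ℝ) :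
    Function.Surjective (linearizedMonodromyMap φ : Param ρ → Param ρ) := by
  rintro ⟨F, G, K, p, q⟩
  have h_two_pi : 2 * Real.pi ≠ 0 := by positivity
  let c := (2 * Real.pi)⁻¹ • F
  let b := (2 * Real.pi)⁻¹ • G
  let m := Real.sin φ • b + Real.cos φ • c
  obtain ⟨g, α, α', h_div⟩ := exists_one_sub_sq_mul_eq (K - (2 : ℝ) • consLoop 0 m)
  let p' := (2 * Real.pi)⁻¹ * p - (eval I (monomial 1 * toRealLoop c)).re
  let q' := (2 * Real.pi)⁻¹ * q - (eval I (monomial 1 * toRealLoop b)).re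
  obtain ⟨θ, β, γ, h_p, h_q, hκ⟩ : ∃ θ β γ, Real.cos φ * θ + γ = p' ∧ Real.sin φ * θ + β = q' ∧
      Real.sin φ * β + Real.cos φ * γ = -α / 2 :=
    ⟨_, _, _, (trig_system_iff φ p' q' (-α / 2) _ _ _).2 ⟨rfl, rfl, rfl⟩⟩
  refine ⟨(g + consLoop (-α / 2) m, consLoop β b, consLoop γ c, α' / 2, θ), ?_⟩
  have h_det : nonnegPart (linearizedDetLoop φ (g + consLoop (-α / 2) m, consLoop β b,
      consLoop γ c, α' / 2, θ)) = K := by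
    rw [nonnegPart_linearizedDetLoop_consLoop_eq_iff, hκ, add_sub_cancel_right, h_div]
    congr <;> ring
  simp only [linearizedMonodromyMap, Param.θ, Prod.mk.injEq, leftShift_consLoop, h_det,
    re_eval_I_consLoop, ← add_assoc, h_p, h_q]
  refine ⟨smul_inv_smul₀ h_two_pi F, smul_inv_smul₀ h_two_pi G, trivial, ?_, ?_⟩
  · rw [sub_add_cancel, mul_inv_cancel_left₀ h_two_pi]
  · rw [sub_add_cancel, mul_inv_cancel_left₀ h_two_pi]

end Linearization

/-! ## Solving by the implicit function theorem -/

section MonodromyMapDerivative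

open RealLoop
open scoped ContDiff

variable {ρ : ℝ} [Fact (1 < ρ)]

section AtTimeZero

variable {φ : ℝ} (h_sin : 0 < Real.sin φ) (h_cos : 0 < Real.cos φ)

theorem pLoop_zero (x : Param ρ) :
    pLoop φ h_sin.ne' (0, x) = (2 * Real.pi * x.r) • loopC φ x := by
  rw [pLoop, realEntries, hatLoop_zero, primitive_realCoeffs_γ_one h_sin, neg_mul_neg, smul_smul]

theorem qLoop_zero (x : Param ρ) :
    qLoop φ h_cos.ne' (0, x) = (2 * Real.pi * x.r) • loopB φ x := by
  rw [qLoop, imagEntries, hatLoop_zero, primitive_imagCoeffs_γ_one h_cos, neg_mul_neg, smul_smul]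

theorem skewPart_smul_monomial_add_toRealLoop (k : ℝ) (g : WRNonneg ρ) :
    skewPart (k • (monomial (-1) + monomial 1) + toRealLoop g) = leftShift 1 g := by
  have h_symm : skewPart (monomial (-1) + monomial 1 : RealLoop ρ) = 0 := by
    refine (skewPart_eq_zero_iff _).2 (RealLoop.ext_of_eval fun z hz => ?_)
    simp only [eval_reverse hz, map_add, eval_monomial hz, zpow_neg_one, zpow_one, map_inv₀,
      ← inv_eq_conj hz, inv_inv, add_comm]
  rw [map_add, map_smul, h_symm, smul_zero, zero_add, skewPart_toRealLoop]

theorem re_eval_exp_smul_monomial_add_toRealLoop (k θ : ℝ) (g : WRNonneg ρ) :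
    (eval (exp (I * θ)) (k • (monomial (-1) + monomial 1) + toRealLoop g)).re =
      2 * k * Real.cos θ + (eval (exp (I * θ)) (toRealLoop g)).re := by
  have h_cosine : exp (I * θ) ^ (-1 : ℤ) + exp (I * θ) = (2 * Real.cos θ : ℝ) := by
    rw [zpow_neg_one, ← exp_neg, ofReal_mul, ofReal_cos, ofReal_ofNat, two_cos, neg_mul,
      mul_comm I, add_comm]
  have hz := norm_exp_I_mul_ofReal θ
  rw [map_add, map_smul, map_add, eval_monomial hz, eval_monomial hz, zpow_one, h_cosine, add_re,
    real_smul, ← ofReal_mul, ofReal_re]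
  ring

theorem monodromyMap_zero (x : Param ρ) :
    monodromyMap φ h_sin.ne' h_cos.ne' (0, x) =
      ((2 * Real.pi * x.r) • leftShift 1 x.2.2.1, (2 * Real.pi * x.r) • leftShift 1 x.2.1,
        nonnegPart (detLoop φ x),
        2 * Real.pi * x.r * (-(Real.cos φ * Real.cos x.θ) +
          (eval (exp (I * x.θ)) (toRealLoop x.2.2.1)).re),
        2 * Real.pi * x.r * (-(Real.sin φ * Real.cos x.θ) +
          (eval (exp (I * x.θ)) (toRealLoop x.2.1)).re)) := by
  simp only [monodromyMap, pLoop_zero h_sin, qLoop_zero h_cos, map_smul, loopB, loopC,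
    skewPart_smul_monomial_add_toRealLoop, smul_re, re_eval_exp_smul_monomial_add_toRealLoop,
    smul_eq_mul, Prod.mk.injEq, true_and]
  constructor <;> ring

theorem monodromyMap_zero_central :
    monodromyMap φ h_sin.ne' h_cos.ne' (0, central ρ) = 0 := by
  rw [monodromyMap_zero h_sin h_cos]
  simp [central, Param.r, Param.θ, detLoop]

end AtTimeZero

section Smoothness

variable {φ : ℝ} {h_sin : Real.sin φ ≠ 0} {h_cos : Real.cos φ ≠ 0}

theorem contDiff_realEntries : ContDiff ℝ ω (realEntries φ : Param ρ → _) := by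
  have h_incl : ContDiff ℝ ω (toRealLoop (ρ := ρ)) := (toRealLoop (ρ := ρ)).contDiff
  unfold realEntries loopA loopB loopC Param.r
  fun_prop

theorem contDiff_imagEntries : ContDiff ℝ ω (imagEntries φ : Param ρ → _) := by
  have h_incl : ContDiff ℝ ω (toRealLoop (ρ := ρ)) := (toRealLoop (ρ := ρ)).contDiff
  unfold imagEntries loopA loopB loopC Param.r
  fun_prop

theorem contDiff_detLoop : ContDiff ℝ ω (detLoop φ : Param ρ → _) := by
  have h_incl : ContDiff ℝ ω (toRealLoop (ρ := ρ)) := (toRealLoop (ρ := ρ)).contDiff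
  unfold detLoop Param.r
  fun_prop

theorem contDiffAt_re_eval_exp {E : Type*} [NormedAddCommGroup E] [NormedSpace ℝ E] {τ : E → ℝ}
    {f : E → RealLoop ρ} {e : E} (hτ : ContDiffAt ℝ ω τ e) (hf : ContDiffAt ℝ ω f e) :
    ContDiffAt ℝ ω (fun e => (eval (exp (I * τ e)) (f e)).re) e := by
  have h_eval : ContDiffAt ℝ ω (fun w => (eval w : RealLoop ρ →L[ℝ] ℂ)) (exp (I * τ e)) :=
    (analyticAt_eval (norm_exp_I_mul_ofReal (τ e))).restrictScalars.contDiffAt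
  have h_exp : ContDiffAt ℝ ω (fun e => exp (I * τ e)) e :=
    (contDiffAt_const.mul (ofRealCLM.contDiff.contDiffAt.comp e hτ)).cexp
  have h_apply := ContDiffAt.clm_apply (h_eval.comp e h_exp) hf
  exact reCLM.contDiff.contDiffAt.comp e h_apply

theorem framesSolvable_zero (x : Param ρ) : FramesSolvable φ h_sin h_cos (0, x) :=
  ⟨frameSolvable_zero _ _, frameSolvable_zero _ _⟩

theorem isOpen_framesSolvable : IsOpen {q : ℝ × Param ρ | FramesSolvable φ h_sin h_cos q} := by
  have h_real : Continuous fun q : ℝ × Param ρ => (q.1, realEntries φ q.2) :=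
    continuous_fst.prodMk ((contDiff_realEntries (ρ := ρ)).continuous.comp continuous_snd)
  have h_imag : Continuous fun q : ℝ × Param ρ => (q.1, imagEntries φ q.2) :=
    continuous_fst.prodMk ((contDiff_imagEntries (ρ := ρ)).continuous.comp continuous_snd)
  exact ((isOpen_frameSolvable _).preimage h_real).inter
    ((isOpen_frameSolvable _).preimage h_imag)

theorem contDiffAt_monodromyMap {q : ℝ × Param ρ} (h : FramesSolvable φ h_sin h_cos q) :
    ContDiffAt ℝ ω (monodromyMap φ h_sin h_cos) q := by
  have hp : ContDiffAt ℝ ω (pLoop φ h_sin) q :=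
    (contDiffAt_hatLoop h.1).comp q (f := fun q : ℝ × Param ρ => (q.1, realEntries φ q.2))
      (contDiffAt_fst.prodMk ((contDiff_realEntries (ρ := ρ)).contDiffAt.comp q contDiffAt_snd))
  have hq : ContDiffAt ℝ ω (qLoop φ h_cos) q :=
    (contDiffAt_hatLoop h.2).comp q (f := fun q : ℝ × Param ρ => (q.1, imagEntries φ q.2))
      (contDiffAt_fst.prodMk ((contDiff_imagEntries (ρ := ρ)).contDiffAt.comp q contDiffAt_snd))
  have hθ : ContDiffAt ℝ ω (fun q : ℝ × Param ρ => q.2.θ) q := by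
    unfold Param.θ
    fun_prop
  have h_skew := (skewPart (ρ := ρ)).contDiff (n := ω)
  have h_det := (nonnegPart (ρ := ρ)).contDiff.contDiffAt.comp q
    ((contDiff_detLoop (ρ := ρ) (φ := φ)).contDiffAt.comp q contDiffAt_snd)
  exact (h_skew.contDiffAt.comp q hp).prodMk ((h_skew.contDiffAt.comp q hq).prodMk (h_det.prodMk
    ((contDiffAt_re_eval_exp hθ hp).prodMk (contDiffAt_re_eval_exp hθ hq))))

end Smoothness

section Derivative

theorem hasDerivAt_shift_smul_leftShift (r : ℝ) (g : WRNonneg ρ) :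
    HasDerivAt (fun s : ℝ => (2 * Real.pi * (1 + s * r)) • leftShift 1 (s • g))
      ((2 * Real.pi) • leftShift 1 g) 0 := by
  refine (hasDerivAt_zero_of_eventually_eq_smul
    (g := fun s : ℝ => (2 * Real.pi * (1 + s * r)) • leftShift 1 g)
    (.of_forall fun s => ?_) (by fun_prop)).congr_deriv ?_
  · rw [map_smul, smul_comm]
  · rw [zero_mul, add_zero, mul_one]

theorem hasDerivAt_nonnegPart_detLoop_line (φ : ℝ) (h : Param ρ) :
    HasDerivAt (fun s : ℝ => nonnegPart (detLoop φ (central ρ + s • h)))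
      (nonnegPart (linearizedDetLoop φ h)) 0 := by
  let quotient (s : ℝ) : RealLoop ρ := (-(2 * h.r + s * h.r ^ 2)) • monomial 1 +
    (1 + s * h.r) ^ 2 • ((1 - monomial 2) * toRealLoop h.1 + (1 + monomial 2) *
      (Real.sin φ • toRealLoop h.2.1 + Real.cos φ • toRealLoop h.2.2.1) +
      s • (monomial 1 * (toRealLoop h.1 ^ 2 - toRealLoop h.2.1 ^ 2 - toRealLoop h.2.2.1 ^ 2)))
  refine (hasDerivAt_zero_of_eventually_eq_smul (g := fun s => nonnegPart (quotient s))
    (.of_forall fun s => ?_) (by fun_prop)).congr_deriv ?_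
  · rw [← map_smul]
    congr 1
    simp only [quotient, detLoop, Param.r, central, Prod.fst_add, Prod.snd_add, Prod.smul_fst,
      Prod.smul_snd, zero_add, map_smul, smul_eq_mul]
    simp only [Algebra.smul_def, map_mul, map_pow, map_sub, map_add, map_neg, map_one, map_ofNat]
    ring
  · congr 1
    simp only [quotient, linearizedDetLoop, zero_mul, add_zero, zero_smul, one_pow, one_smul,
      neg_smul]
    abel

theorem hasDerivAt_re_eval_line (k r θ : ℝ) (g : WRNonneg ρ) :
    HasDerivAt (fun s : ℝ => 2 * Real.pi * (1 + s * r) *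
        (-(k * Real.cos (Real.pi / 2 + s * θ)) +
          (eval (exp (I * (Real.pi / 2 + s * θ : ℝ))) (toRealLoop (s • g))).re))
      (2 * Real.pi * (k * θ + (eval I (toRealLoop g)).re)) 0 := by
  have h_exp : exp (I * ((Real.pi / 2 : ℝ) : ℂ)) = I := by
    rw [mul_comm, ofReal_div, ofReal_ofNat, exp_pi_div_two_mul_I]
  have h_factor : HasDerivAt (fun s : ℝ => 2 * Real.pi * (1 + s * r)) (2 * Real.pi * r) 0 := by
    simpa using (((hasDerivAt_id (0 : ℝ)).mul_const r).const_add 1).const_mul (2 * Real.pi)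
  have h_cosine : HasDerivAt (fun s : ℝ => -(k * Real.cos (Real.pi / 2 + s * θ))) (k * θ) 0 := by
    simpa using
      ((((hasDerivAt_id (0 : ℝ)).mul_const θ).const_add (Real.pi / 2)).cos.const_mul k).fun_neg
  have h_cont := (contDiffAt_re_eval_exp (e := (0 : ℝ)) (τ := fun s : ℝ => Real.pi / 2 + s * θ)
    (f := fun _ => toRealLoop g) (by fun_prop) contDiffAt_const).continuousAt
  have h_eval := hasDerivAt_zero_of_eventually_eq_smul (f := fun s : ℝ =>
    (eval (exp (I * (Real.pi / 2 + s * θ : ℝ))) (toRealLoop (s • g))).re)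
    (.of_forall fun s => by rw [map_smul, map_smul, smul_re]) h_cont
  refine (h_factor.mul (h_cosine.add h_eval)).congr_deriv ?_
  simp [-ofReal_div, h_exp]

variable {φ : ℝ} (h_sin : 0 < Real.sin φ) (h_cos : 0 < Real.cos φ)

theorem hasDerivAt_monodromyMap_line (h : Param ρ) :
    HasDerivAt (fun s : ℝ => monodromyMap φ h_sin.ne' h_cos.ne' (0, central ρ + s • h))
      (linearizedMonodromyMap φ h) 0 := by
  have h_r (s : ℝ) : (central ρ + s • h).r = 1 + s * h.r := rfl
  have h_θ (s : ℝ) : (central ρ + s • h).θ = Real.pi / 2 + s * h.θ := rfl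
  have h_b (s : ℝ) : (central ρ + s • h).2.1 = s • h.2.1 := zero_add _
  have h_c (s : ℝ) : (central ρ + s • h).2.2.1 = s • h.2.2.1 := zero_add _
  simp only [monodromyMap_zero h_sin h_cos, h_r, h_θ, h_b, h_c]
  exact (hasDerivAt_shift_smul_leftShift h.r h.2.2.1).prodMk
    ((hasDerivAt_shift_smul_leftShift h.r h.2.1).prodMk
    ((hasDerivAt_nonnegPart_detLoop_line φ h).prodMk
    ((hasDerivAt_re_eval_line (Real.cos φ) h.r h.θ h.2.2.1).prodMk
      (hasDerivAt_re_eval_line (Real.sin φ) h.r h.θ h.2.1))))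

theorem fderiv_monodromyMap_comp_inr_apply (h : Param ρ) :
    (fderiv ℝ (monodromyMap φ h_sin.ne' h_cos.ne') (0, central ρ) ∘L .inr ℝ ℝ (Param ρ)) h =
      linearizedMonodromyMap φ h := by
  have h_fderiv := ((contDiffAt_monodromyMap (framesSolvable_zero (h_sin := h_sin.ne')
    (h_cos := h_cos.ne') (central ρ))).differentiableAt (by simp)).hasFDerivAt
  have h_line : HasDerivAt (fun s : ℝ => ((0 : ℝ), central ρ + s • h)) (0, h) 0 := by
    refine (hasDerivAt_const (0 : ℝ) (0 : ℝ)).prodMk ?_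
    simpa using ((hasDerivAt_id (0 : ℝ)).smul_const h).const_add (central ρ)
  exact (HasFDerivAt.comp_hasDerivAt_of_eq (0 : ℝ) h_fderiv h_line (by simp)).unique
    (hasDerivAt_monodromyMap_line h_sin h_cos h)

theorem isInvertible_fderiv_monodromyMap :
    (fderiv ℝ (monodromyMap φ h_sin.ne' h_cos.ne') (0, central ρ) ∘L
      .inr ℝ ℝ (Param ρ)).IsInvertible := by
  have h_apply := fderiv_monodromyMap_comp_inr_apply (ρ := ρ) h_sin h_cos
  refine ⟨ContinuousLinearEquiv.ofBijective _ ?_ ?_, ContinuousLinearEquiv.coe_ofBijective _ _ _⟩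
  · exact LinearMap.ker_eq_bot'.2 fun x hx =>
      eq_zero_of_linearizedMonodromyMap_eq_zero (φ := φ) ((h_apply x).symm.trans hx)
  · refine LinearMap.range_eq_top.2 fun y => ?_
    obtain ⟨x, hx⟩ := linearizedMonodromyMap_surjective φ y
    exact ⟨x, (h_apply x).trans hx⟩

end Derivative

end MonodromyMapDerivative

section ImplicitFunction

open scoped ContDiff

theorem exists_analyticOnNhd_implicit {E F : Type*} [NormedAddCommGroup E] [NormedSpace ℝ E]
    [CompleteSpace E] [NormedAddCommGroup F] [NormedSpace ℝ F] [CompleteSpace F]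
    {f : ℝ × E → F} {a : E} (hf : ContDiffAt ℝ ω f (0, a))
    (h_inv : (fderiv ℝ f (0, a) ∘L .inr ℝ ℝ E).IsInvertible) {P : ℝ × E → Prop}
    (hP : ∀ᶠ q in 𝓝 (0, a), P q) :
    ∃ ε > 0, ∃ U ∈ 𝓝 a, ∃ x : ℝ → E, x 0 = a ∧ AnalyticOnNhd ℝ x (Ioo (-ε) ε) ∧
      ∀ t ∈ Ioo (-ε) ε, x t ∈ U ∧ ∀ y ∈ U, P (t, y) ∧ (f (t, y) = f (0, a) ↔ x t = y) := by
  have hω : (ω : WithTop ℕ∞) ≠ 0 := by simp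
  let x := hf.implicitFunction hω h_inv
  have hx_zero : x 0 = a := hf.implicitFunction_apply_self hω h_inv
  have hx_analytic : AnalyticAt ℝ x 0 := (hf.contDiffAt_implicitFunction hω h_inv).analyticAt
  obtain ⟨T, hT, U, hU, hTU⟩ :=
    mem_nhds_prod_iff.1 (hP.and (hf.eventually_apply_eq_iff_implicitFunction hω h_inv))
  have hx_mem : ∀ᶠ t in 𝓝 (0 : ℝ), x t ∈ U := hx_analytic.continuousAt (hx_zero.symm ▸ hU)
  obtain ⟨ε, hε, h_ball⟩ := Metric.eventually_nhds_iff_ball.1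
    ((hx_mem.and hx_analytic.eventually_analyticAt).and hT)
  rw [Real.ball_eq_Ioo, zero_sub, zero_add] at h_ball
  exact ⟨ε, hε, U, hU, x, hx_zero, fun t ht => (h_ball t ht).1.2, fun t ht =>
    ⟨(h_ball t ht).1.1, fun y hy => hTU (mk_mem_prod (h_ball t ht).2 hy)⟩⟩

variable {ρ : ℝ} [Fact (1 < ρ)] {φ : ℝ} (h_sin : Real.sin φ ≠ 0) (h_cos : Real.cos φ ≠ 0)

theorem eventually_r_pos :
    ∀ᶠ q in 𝓝 ((0 : ℝ), central ρ), 0 < q.2.r := by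
  have h_cont : Continuous fun q : ℝ × Param ρ => q.2.r := by
    unfold Param.r
    fun_prop
  exact (isOpen_Ioi.preimage h_cont).mem_nhds (one_pos : (0 : ℝ) < 1)

theorem eventually_solvesMonodromyProblem_iff :
    ∀ᶠ q in 𝓝 ((0 : ℝ), central ρ),
      SolvesMonodromyProblem φ q.1 q.2 ↔ monodromyMap φ h_sin h_cos q = 0 := by
  have h_solvable : ∀ᶠ q in 𝓝 ((0 : ℝ), central ρ), FramesSolvable φ h_sin h_cos q :=
    isOpen_framesSolvable.mem_nhds (framesSolvable_zero _)
  have h_cont : Continuous fun q : ℝ × Param ρ => q.2.θ := by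
    unfold Param.θ
    fun_prop
  have hθ : ∀ᶠ q in 𝓝 ((0 : ℝ), central ρ), q.2.θ ∈ Ioo 0 Real.pi :=
    (isOpen_Ioo.preimage h_cont).mem_nhds ⟨half_pos Real.pi_pos, half_lt_self Real.pi_pos⟩
  filter_upwards [h_solvable, hθ] with q hq hq_θ
  rw [solvesMonodromyProblem_iff hq, and_iff_right hq_θ]

end ImplicitFunction

end DPW

end

theorem mainTheorem9 (ρ : ℝ) [Fact (1 < ρ)] (φ : ℝ) (hφ : φ ∈ Set.Ioo 0 (Real.pi / 2)) :
    ∃ ε > 0, ∃ U ∈ 𝓝 (DPW.central ρ), ∃ x : ℝ → DPW.Param ρ,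
      x 0 = DPW.central ρ ∧
      AnalyticOnNhd ℝ x (Set.Ioo (-ε) ε) ∧
      ∀ t ∈ Set.Ioo (-ε) ε,
        x t ∈ U ∧
        DPW.IsSymmetric φ (DPW.potential φ t (x t)) ∧
        (t ≠ 0 → DPW.IsDPWPotential φ (DPW.potential φ t (x t))) ∧
        DPW.SolvesMonodromyProblem φ t (x t) ∧
        ∀ y ∈ U, DPW.SolvesMonodromyProblem φ t y → y = x t := by
  have h_sin : 0 < Real.sin φ := Real.sin_pos_of_pos_of_lt_pi hφ.1 (by linarith [hφ.2, hφ.1])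
  have h_cos : 0 < Real.cos φ := Real.cos_pos_of_mem_Ioo ⟨by linarith [hφ.1, hφ.2], hφ.2⟩
  obtain ⟨ε, hε, U, hU, x, hx_zero, hx_analytic, hx⟩ := DPW.exists_analyticOnNhd_implicit
    (DPW.contDiffAt_monodromyMap (DPW.framesSolvable_zero (DPW.central ρ)))
    (DPW.isInvertible_fderiv_monodromyMap h_sin h_cos)
    ((DPW.eventually_solvesMonodromyProblem_iff h_sin.ne' h_cos.ne').and DPW.eventually_r_pos)
  simp only [DPW.monodromyMap_zero_central h_sin h_cos] at hx
  refine ⟨ε, hε, U, hU, x, hx_zero, hx_analytic, fun t ht => ?_⟩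
  obtain ⟨hxU, hU_iff⟩ := hx t ht
  obtain ⟨⟨h_solves, hr⟩, h_implicit⟩ := hU_iff (x t) hxU
  refine ⟨hxU, DPW.isSymmetric_potential φ t (x t), fun ht_ne =>
    DPW.isDPWPotential_potential h_sin.ne' h_cos.ne' (mul_ne_zero hr.ne' ht_ne),
    h_solves.2 (h_implicit.2 rfl), fun y hy hy_solves => ?_⟩
  obtain ⟨⟨hy_iff, -⟩, hy_implicit⟩ := hU_iff y hy
  exact (hy_implicit.1 (hy_iff.1 hy_solves)).symm
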